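/- Let $A$ be a finite alphabet, $A^*$ the set of words over $A$ (including the empty word $\epsilon$), and let $\langle A \mid R\rangle$ be a finite monoid presentation, so $R \subseteq A^*\times A^*$ is finite. Write $u \equiv v$ if there is a finite sequence of words from $u$ to $v$ in which consecutive words have the form $axb$, $ayb$ with $a, b \in A^*$ and $(x,y)\in R$ or $(y,x)\in R$. A relation word is a word which is one side of a relation in $R$; a piece is the empty word or a word which occurs as a factor of two different relation words, or of the same relation word in two different (possibly overlapping) places. The presentation satisfies $C(4)$ if no relation word is a product of strictly fewer than $4$ pieces (the empty product being $\epsilon$). A deterministic 2-tape automaton over alphabets $A_1, A_2$ consists of a finite state set $Q$ partitioned into $Q_1$ and $Q_2$, an initial state, a set of terminal states, and partial functions $\delta_i : Q_i \times (A_i\cup\{\$\}) \to Q$ $(i=1,2)$, where $\$$ is an end-marker not in $A_1 \cup A_2$. In a state $p \in Q_i$ the automaton reads the next symbol $a$ of tape $i$ and moves to $\delta_i(p,a)$, if this is defined. It accepts $(u,v) \in A_1^*\times A_2^*$ if, started in the initial state with $u\$$ and $v\$$ on the tapes, it can reach a terminal state with both tapes completely read. A relation $T \subseteq A_1^*\times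 A_2^*$ is deterministic rational if it is the set of pairs accepted by some deterministic 2-tape automaton, and reverse deterministic rational if the reverse relation $\{(u^R,v^R) \mid (u,v)\in T\}$ is deterministic rational, where $w^R$ is the word $w$ written backwards. **Theorem.** Let $\langle A \mid R\rangle$ be a finite monoid presentation satisfying $C(4)$. Then the relation $$\{(u,v)\in A^*\times A^* \mid u\equiv v\}$$ is deterministic rational and reverse deterministic rational. Moreover, one can, starting from the presentation, effectively compute deterministic 2-tape automata recognising this relation and its reverse: there is a computable function which maps each finite presentation satisfying $C(4)$ (given as the size $n$ of its alphabet $\{0,\dots,n-1\}$ and the list of its relations) to a pair consisting of the explicit transition tables of a deterministic 2-tape automaton accepting the relation and of one accepting its reverse. -/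

import Mathlib

namespace SmallOverlap

/-! ### Monoid presentations and small overlap conditions

Words over `A` are lists. A presentation over the alphabet `A` is given by its set of relations
`R : Set (List A × List A)`. -/

section Presentation

variable {A : Type*}

/-- `u` and `v` are one-step equivalent: `u = a x b` and `v = a y b` where `(x, y)` or `(y, x)` is a
relation. -/
def OneStep (R : Set (List A × List A)) (u v : List A) : Prop :=
  ∃ a b x y : List A, ((x, y) ∈ R ∨ (y, x) ∈ R) ∧ u = a ++ x ++ b ∧ v = a ++ y ++ b

/-- `u ≡ v`: there is a finite sequence of one-step equivalences from `u` to `v`. -/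
def Equivalent (R : Set (List A × List A)) : List A → List A → Prop :=
  Relation.ReflTransGen (OneStep R)

/-- The word problem relation `{(u, v) | u ≡ v}`. -/
def wordProblem (R : Set (List A × List A)) : Set (List A × List A) :=
  {p | Equivalent R p.1 p.2}

/-- A relation word is a word that is one side of a relation. -/
def IsRelationWord (R : Set (List A × List A)) (w : List A) : Prop :=
  ∃ x, (w, x) ∈ R ∨ (x, w) ∈ R

/-- A piece is a word with two different occurrences as a factor of relation words: in two
different relation words, or in the same relation word in two different places (the place of an
occurrence being determined by what precedes it). The empty word always counts as a piece. -/
def IsPiece (R : Set (List A × List A)) (p : List A) : Prop :=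
  p = [] ∨ ∃ w₁ w₂ s₁ t₁ s₂ t₂ : List A, IsRelationWord R w₁ ∧ IsRelationWord R w₂ ∧
    w₁ = s₁ ++ p ++ t₁ ∧ w₂ = s₂ ++ p ++ t₂ ∧ (w₁ ≠ w₂ ∨ s₁ ≠ s₂)

/-- The condition `C(m)`: no relation word is a product of strictly fewer than `m` pieces.
(The product of zero pieces is the empty word.) -/
def SatisfiesC (m : ℕ) (R : Set (List A × List A)) : Prop :=
  ∀ w, IsRelationWord R w →
    ¬ ∃ ps : List (List A), ps.length < m ∧ (∀ p ∈ ps, IsPiece R p) ∧ ps.flatten = w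

end Presentation

/-! ### Deterministic 2-tape automata -/

/-- The alphabet with an end-marker adjoined; `none` is the end-marker. -/
abbrev EndMarked (A : Type*) := Option A

/-- The word `u$`. -/
def endMark {A : Type*} (u : List A) : List (EndMarked A) :=
  u.map some ++ [none]

/-- A deterministic 2-tape automaton with state set `Q`, partitioned into `Q₁` (states that read
the first tape) and its complement `Q₂` (states that read the second tape). -/
structure TwoTapeDFA (A₁ A₂ Q : Type*) where
  /-- the states that read the first tape -/
  Q₁ : Set Q
  /-- the initial state -/
  start : Q
  /-- the terminal states -/
  terminal : Set Q
  /-- the partial transition function on `Q₁` -/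
  δ₁ : {q // q ∈ Q₁} → EndMarked A₁ → Option Q
  /-- the partial transition function on `Q₂` -/
  δ₂ : {q // q ∉ Q₁} → EndMarked A₂ → Option Q

namespace TwoTapeDFA

variable {A₁ A₂ Q : Type*}

/-- One move of the automaton; a configuration consists of the unread parts of the two tapes and
the current state. -/
inductive Step (M : TwoTapeDFA A₁ A₂ Q) :
    List (EndMarked A₁) × List (EndMarked A₂) × Q →
    List (EndMarked A₁) × List (EndMarked A₂) × Q → Prop
  | tape₁ (a : EndMarked A₁) (u : List (EndMarked A₁)) (v : List (EndMarked A₂)) (p q : Q)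
      (hp : p ∈ M.Q₁) (h : M.δ₁ ⟨p, hp⟩ a = some q) : Step M (a :: u, v, p) (u, v, q)
  | tape₂ (b : EndMarked A₂) (u : List (EndMarked A₁)) (v : List (EndMarked A₂)) (p q : Q)
      (hp : p ∉ M.Q₁) (h : M.δ₂ ⟨p, hp⟩ b = some q) : Step M (u, b :: v, p) (u, v, q)

/-- The relation accepted by the automaton. -/
def accepts (M : TwoTapeDFA A₁ A₂ Q) : Set (List A₁ × List A₂) :=
  {p | ∃ q ∈ M.terminal,
    Relation.ReflTransGen M.Step (endMark p.1, endMark p.2, M.start) ([], [], q)}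

end TwoTapeDFA

/-- A relation is deterministic rational if it is accepted by some finite deterministic 2-tape
automaton. -/
def IsDeterministicRational {A₁ A₂ : Type*} (T : Set (List A₁ × List A₂)) : Prop :=
  ∃ (Q : Type) (_ : Finite Q) (M : TwoTapeDFA A₁ A₂ Q), M.accepts = T

/-- The relation `{(uᴿ, vᴿ) | (u, v) ∈ T}`. -/
def reverseRelation {A₁ A₂ : Type*} (T : Set (List A₁ × List A₂)) : Set (List A₁ × List A₂) :=
  (fun p => (p.1.reverse, p.2.reverse)) '' T

/-- A relation is reverse deterministic rational if its reverse is deterministic rational. -/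
def IsReverseDeterministicRational {A₁ A₂ : Type*} (T : Set (List A₁ × List A₂)) : Prop :=
  IsDeterministicRational (reverseRelation T)

/-! ### Presentations and automata as finite data for algorithms -/

/-- Finite data for a presentation: the size `n` of the alphabet `{0, …, n - 1}`, and the list of
relations. -/
abbrev PresentationCode := ℕ × List (List ℕ × List ℕ)

/-- The presentation over `Fin n` with the listed relations, as finite data. -/
def encodePresentation (n : ℕ) (L : List (List (Fin n) × List (Fin n))) : PresentationCode :=
  (n, L.map fun r => (r.1.map Fin.val, r.2.map Fin.val))

/-- Finite data for a 2-tape automaton: the states, the states that read the first tape, the initial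
state, the terminal states, and the transition table. -/
abbrev AutomatonCode := List ℕ × List ℕ × ℕ × List ℕ × List (ℕ × Option ℕ × ℕ)

namespace AutomatonCode

/-- the list of states -/
def states (c : AutomatonCode) : List ℕ := c.1
/-- the list of states that read the first tape -/
def firstTape (c : AutomatonCode) : List ℕ := c.2.1
/-- the initial state -/
def start (c : AutomatonCode) : ℕ := c.2.2.1
/-- the list of terminal states -/
def terminal (c : AutomatonCode) : List ℕ := c.2.2.2.1
/-- the transition table: triples of a state, an input symbol (`none` being the end-marker) and the
resulting state -/
def transitions (c : AutomatonCode) : List (ℕ × Option ℕ × ℕ) := c.2.2.2.2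

/-- The finite data `c` describe the automaton `M`, whose states are those listed in `c`. -/
structure Describes {n₁ n₂ : ℕ} (c : AutomatonCode)
    (M : TwoTapeDFA (Fin n₁) (Fin n₂) {q : ℕ // q ∈ states c}) : Prop where
  firstTape_iff : ∀ q : {q : ℕ // q ∈ states c}, (q : ℕ) ∈ firstTape c ↔ q ∈ M.Q₁
  start_eq : (M.start : ℕ) = start c
  terminal_iff : ∀ q : {q : ℕ // q ∈ states c}, (q : ℕ) ∈ terminal c ↔ q ∈ M.terminal
  δ₁_iff : ∀ (p q : {q : ℕ // q ∈ states c}) (hp : p ∈ M.Q₁) (a : EndMarked (Fin n₁)),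
    ((p : ℕ), a.map Fin.val, (q : ℕ)) ∈ transitions c ↔ M.δ₁ ⟨p, hp⟩ a = some q
  δ₂_iff : ∀ (p q : {q : ℕ // q ∈ states c}) (hp : p ∉ M.Q₁) (b : EndMarked (Fin n₂)),
    ((p : ℕ), b.map Fin.val, (q : ℕ)) ∈ transitions c ↔ M.δ₂ ⟨p, hp⟩ b = some q

/-- The finite data `c` describe a deterministic 2-tape automaton that accepts the relation `T`. -/
def Recognises {n₁ n₂ : ℕ} (c : AutomatonCode) (T : Set (List (Fin n₁) × List (Fin n₂))) : Prop :=
  ∃ M : TwoTapeDFA (Fin n₁) (Fin n₂) {q : ℕ // q ∈ states c}, Describes c M ∧ M.accepts = T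

end AutomatonCode

end SmallOverlap

/-!
The word problem of a `C(4)` presentation can be solved by reading both words from left to right
with a bounded memory.

Every relation word is written as `XYZ`, where `X` and `Z` are its longest prefix and suffix that
are pieces; by `C(4)` the middle word `Y` exists and is not a piece, so that an occurrence of `Y` in
a relation word determines the relation word and the place. Relation words that the relations
connect with each other are called complementary. The equivalence `≡` coincides with an inductively
defined relation `Eqv` that can be read from left to right: either the first letters agree and are
deleted, or the words are `XYu` and `X'Y'v` with `XYZ` and `X'Y'Z'` complementary, and `u` and `v`
can be rewritten to begin with `Z` and `Z'` in a compatible way (`equivalent_iff_eqv`). What has to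
be proved is that `Eqv` is transitive, and this rests on `not_head_inside`: if `u` can be rewritten
to begin with `Z`, then no other prefix `X'Y'` of a relation word starts inside the `XY` of `XYu`.

This determines when the beginning `XY` of a word can be rewritten. The statements that an algorithm
has to keep track of are those of the form `Holds U V p`: `U ≡ V`, and these words can be rewritten
to begin with the piece `p`, a promise made by an earlier rewriting. Each of them is either refuted
or reduced to another one that deletes a part of `U` and of `V`, and this depends on prefixes of
bounded length only (`plan_sound`, `plan_take`). The words that a reduction puts in front of `U`
and `V`, and the new promises, are pieces. So a state of a 2-tape automaton can record the known
part of each word and the promise. It reads a letter if one of the known parts is too short, and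
otherwise it reduces; each reduction uses up letters that have been read, so that the known parts
stay bounded and reductions come to an end (`iterate_spec`). The automaton accepts exactly the pairs
that `Eqv` relates (`run_iff`, `mem_accepts_dfa`). In this the end-marker is treated as one more
letter, `n` over the alphabet `{0, …, n - 1}`, that does not occur in the relations.

All functions involved are compositions of primitive recursive ones, whence the computability of the
automata. The condition `C(4)` and the equivalence are invariant under reversal of all words, so the
automaton for the reversed presentation accepts the reverse of the relation. For an arbitrary finite
alphabet the letters are renamed to `0, …, n - 1`.
-/

namespace SmallOverlap

section Theory

variable {A : Type*} {R : Set (List A × List A)}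

/-! ### Factorisations of relation words -/

/-- A triple of words `(X, Y, Z)`, thought of as a factorisation `XYZ` of a relation word. -/
abbrev Triple (A : Type*) := List A × List A × List A

namespace Triple

/-- The first factor. -/
abbrev X (r : Triple A) : List A := r.1
/-- The middle factor. -/
abbrev Y (r : Triple A) : List A := r.2.1
/-- The last factor. -/
abbrev Z (r : Triple A) : List A := r.2.2
/-- The word `XY`. -/
def head (r : Triple A) : List A := r.X ++ r.Y
/-- The factorised word `XYZ`. -/
def word (r : Triple A) : List A := r.X ++ r.Y ++ r.Z

theorem word_eq (r : Triple A) : r.word = r.head ++ r.Z := rfl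

end Triple

/-- `XYZ` is a relation word, `X` its longest prefix that is a piece, `Z` its longest suffix that is
a piece, and the middle word `Y` is not a piece. -/
structure IsFact (R : Set (List A × List A)) (r : Triple A) : Prop where
  word : IsRelationWord R r.word
  pieceX : IsPiece R r.X
  pieceZ : IsPiece R r.Z
  middle : ¬ IsPiece R r.Y
  maxX : ∀ p t, r.word = p ++ t → IsPiece R p → p.length ≤ r.X.length
  maxZ : ∀ s p, r.word = s ++ p → IsPiece R p → p.length ≤ r.Z.length

theorem IsPiece.of_factor {s p t : List A} (h : IsPiece R (s ++ p ++ t)) : IsPiece R p := by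
  rcases h with h | ⟨w₁, w₂, s₁, t₁, s₂, t₂, h₁, h₂, e₁, e₂, hne⟩
  · left
    simp_all
  · refine Or.inr ⟨w₁, w₂, s₁ ++ s, t ++ t₁, s₂ ++ s, t ++ t₂, h₁, h₂, by simp [e₁], by simp [e₂], ?_⟩
    rcases hne with hne | hne
    · exact Or.inl hne
    · exact Or.inr fun h => hne (List.append_cancel_right h)

theorem IsPiece.of_prefix {p t : List A} (h : IsPiece R (p ++ t)) : IsPiece R p :=
  IsPiece.of_factor (s := []) h

theorem IsPiece.of_suffix {s p : List A} (h : IsPiece R (s ++ p)) : IsPiece R p :=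
  IsPiece.of_factor (t := []) (by simpa using h)

theorem exists_longest_piece_prefix (w : List A) :
    ∃ X t, w = X ++ t ∧ IsPiece R X ∧ ∀ p t', w = p ++ t' → IsPiece R p → p.length ≤ X.length := by
  classical
  have h0 : IsPiece R (w.take 0) := Or.inl (by simp)
  have hs := Nat.findGreatest_spec (P := fun i => IsPiece R (w.take i)) (Nat.zero_le w.length) h0
  refine ⟨_, _, (List.take_append_drop _ w).symm, hs, fun p t' h hp => ?_⟩
  have hle : p.length ≤ w.length := by simp [h]
  have := Nat.le_findGreatest (P := fun i => IsPiece R (w.take i)) hle (by simpa [h] using hp)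
  rw [List.length_take]
  exact le_min this hle

theorem exists_longest_piece_suffix (w : List A) :
    ∃ s Z, w = s ++ Z ∧ IsPiece R Z ∧ ∀ s' p, w = s' ++ p → IsPiece R p → p.length ≤ Z.length := by
  classical
  have h0 : IsPiece R (w.drop (w.length - 0)) := Or.inl (by simp)
  have hs := Nat.findGreatest_spec (P := fun i => IsPiece R (w.drop (w.length - i)))
    (Nat.zero_le w.length) h0
  refine ⟨_, _, (List.take_append_drop _ w).symm, hs, fun s' p h hp => ?_⟩
  have hle : p.length ≤ w.length := by simp [h]
  have := Nat.le_findGreatest (P := fun i => IsPiece R (w.drop (w.length - i))) hle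
    (by simpa [h] using hp)
  rw [List.length_drop]
  omega

/-- By `C(4)` a relation word is not a product of three pieces, so that its longest prefix and its
longest suffix that are pieces do not meet, and what lies between them is not a piece. -/
theorem exists_isFact (hC : SatisfiesC 4 R) {w : List A} (hw : IsRelationWord R w) :
    ∃ r, IsFact R r ∧ r.word = w := by
  obtain ⟨X, t, e₁, hX, maxX⟩ := exists_longest_piece_prefix (R := R) w
  obtain ⟨s, Z, e₂, hZ, maxZ⟩ := exists_longest_piece_suffix (R := R) w
  rcases List.append_eq_append_iff.1 (e₁.symm.trans e₂) with ⟨Y, rfl, rfl⟩ | ⟨c, rfl, rfl⟩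
  · refine ⟨(X, Y, Z), ⟨?_, hX, hZ, fun hY => hC w hw ⟨[X, Y, Z], by simp, by simp_all, by simp [e₁]⟩,
      ?_, ?_⟩, by simp [Triple.word, e₁]⟩
    · simpa [Triple.word, ← e₂] using hw
    · simpa [Triple.word, ← e₂] using maxX
    · simpa [Triple.word, ← e₂] using maxZ
  · have : IsPiece R t := hZ.of_suffix
    exact absurd ⟨[s ++ c, t], by simp, by simp_all, by simp [e₁]⟩ (hC w hw)

namespace IsFact

variable {r s k : Triple A}

theorem ext (hr : IsFact R r) (hs : IsFact R s) (h : r.word = s.word) : r = s := by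
  have h₁ : r.X.length = s.X.length := le_antisymm
    (hs.maxX r.X (r.Y ++ r.Z) (by rw [← h]; simp [Triple.word]) hr.pieceX)
    (hr.maxX s.X (s.Y ++ s.Z) (by rw [h]; simp [Triple.word]) hs.pieceX)
  have h₂ : r.Z.length = s.Z.length := le_antisymm
    (hs.maxZ (r.X ++ r.Y) r.Z (by rw [← h]; simp [Triple.word]) hr.pieceZ)
    (hr.maxZ (s.X ++ s.Y) s.Z (by rw [h]; simp [Triple.word]) hs.pieceZ)
  obtain ⟨h₃, h₄⟩ := List.append_inj' h h₂
  obtain ⟨h₅, h₆⟩ := List.append_inj h₃ h₁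
  exact Prod.ext h₅ (Prod.ext h₆ h₄)

/-- A middle word occurs in a single relation word, and there in a single place. -/
theorem eq_of_middle (hr : IsFact R r) (hs : IsFact R s) {c t : List A}
    (h : r.word = c ++ s.Y ++ t) : r = s ∧ c = s.X := by
  by_contra hne
  refine hs.middle (Or.inr ⟨_, _, c, t, s.X, s.Z, hr.word, hs.word, h, rfl, ?_⟩)
  by_contra h'
  push Not at h'
  exact hne ⟨hr.ext hs h'.1, h'.2⟩

theorem piece_of_two (hr : IsFact R r) (hs : IsFact R s) {p c t d e : List A}
    (h₁ : r.word = c ++ p ++ t) (h₂ : s.word = d ++ p ++ e) (hne : c ≠ d) : IsPiece R p :=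
  Or.inr ⟨_, _, c, t, d, e, hr.word, hs.word, h₁, h₂, Or.inr hne⟩

theorem Y_ne_nil (hr : IsFact R r) : r.Y ≠ [] := fun h => hr.middle (Or.inl h)

theorem head_ne_nil (hr : IsFact R r) : r.head ≠ [] := by
  simp [Triple.head, hr.Y_ne_nil]

theorem not_piece_head (hr : IsFact R r) : ¬ IsPiece R r.head :=
  fun h => hr.middle h.of_suffix

/-- A word has at most one prefix of the form `XY`. -/
theorem head_unique (hr : IsFact R r) (hs : IsFact R s) {u v : List A}
    (h : r.head ++ u = s.head ++ v) : r = s ∧ u = v := by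
  have key : r = s := by
    rcases List.append_eq_append_iff.1 h with ⟨m, h₁, -⟩ | ⟨m, h₁, -⟩
    · refine (hs.eq_of_middle hr (c := r.X) (t := m ++ s.Z) ?_).1.symm
      rw [Triple.word_eq, h₁]; simp [Triple.head]
    · refine (hr.eq_of_middle hs (c := s.X) (t := m ++ r.Z) ?_).1
      rw [Triple.word_eq, h₁]; simp [Triple.head]
  subst key
  exact ⟨rfl, List.append_cancel_left h⟩

/-- A piece that starts a word beginning with `XY` is a prefix of `X`. -/
theorem prefix_X (hr : IsFact R r) {p x q : List A} (hp : IsPiece R p)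
    (h : p ++ x = r.head ++ q) : ∃ m, r.X = p ++ m ∧ x = m ++ r.Y ++ q := by
  rcases List.append_eq_append_iff.1 h with ⟨m, h₁, h₂⟩ | ⟨m, h₁, -⟩
  · have hlen := hr.maxX p (m ++ r.Z) (by simp [Triple.word_eq, h₁]) hp
    rcases List.append_eq_append_iff.1 (show r.X ++ r.Y = p ++ m from h₁) with
      ⟨m', h₃, h₄⟩ | ⟨m', h₃, h₄⟩
    · have : m' = [] := by
        rw [h₃] at hlen
        simpa using hlen
      subst this
      exact ⟨[], by simp_all, by simp_all⟩
    · exact ⟨m', h₃, by simp [h₂, h₄]⟩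
  · exact absurd (h₁ ▸ hp).of_prefix hr.not_piece_head

/-- At most one piece can be put before a given word so as to create a prefix of the form `XY`. -/
theorem piece_unique (hr : IsFact R r) (hs : IsFact R s) {z z' x q q' : List A}
    (hz : IsPiece R z) (hz' : IsPiece R z') (h : z ++ x = r.head ++ q)
    (h' : z' ++ x = s.head ++ q') : z = z' := by
  obtain ⟨m, e₁, e₂⟩ := hr.prefix_X hz h
  obtain ⟨n, e₃, e₄⟩ := hs.prefix_X hz' h'
  rcases List.append_eq_append_iff.1 (e₂.symm.trans e₄) with ⟨c, h₁, -⟩ | ⟨c, h₁, -⟩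
  · obtain ⟨rfl, h₂⟩ := hs.eq_of_middle hr (c := z' ++ m) (t := c ++ s.Z) (by
      have : s.word = z' ++ (n ++ s.Y) ++ s.Z := by simp [Triple.word, e₃]
      rw [this, h₁]; simp)
    exact (List.append_cancel_right (h₂.trans e₁)).symm
  · obtain ⟨rfl, h₂⟩ := hr.eq_of_middle hs (c := z ++ n) (t := c ++ r.Z) (by
      have : r.word = z ++ (m ++ r.Y) ++ r.Z := by simp [Triple.word, e₁]
      rw [this, h₁]; simp)
    exact List.append_cancel_right (h₂.trans e₃)

end IsFact

/-- Two factorised relation words are complementary if the relations connect them with each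
other. -/
def Comp (R : Set (List A × List A)) (r s : Triple A) : Prop :=
  IsFact R r ∧ IsFact R s ∧ Relation.EqvGen (fun x y => (x, y) ∈ R) r.word s.word

namespace Comp

variable {r s k : Triple A}

theorem refl (hr : IsFact R r) : Comp R r r := ⟨hr, hr, .refl _⟩
theorem symm (h : Comp R r s) : Comp R s r := ⟨h.2.1, h.1, h.2.2.symm⟩
theorem trans (h : Comp R r s) (h' : Comp R s k) : Comp R r k :=
  ⟨h.1, h'.2.1, h.2.2.trans _ _ _ h'.2.2⟩

end Comp

/-! ### A syntax-directed description of the equivalence -/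

/-- With index `none`, this is a relation `Eqv` on words that will turn out to be `≡`: two words are
related if their first letters agree and the remaining words are related, or if they are `XYu` and
`X'Y'v` with `XYZ` and `X'Y'Z'` complementary, `u` related to some `Zx` and `v` to some `Z'x'`,
where `x` and `x'` are linked. With index `some r`, it is the relation `Link r` between words `x`
that can follow the complements of `r`: it is generated by the pairs `x`, `x'` such that `Zx` and
`Zx'` are related for the last factor `Z` of some complement of `r`. -/
inductive Rewr (R : Set (List A × List A)) : Option (Triple A) → List A → List A → Prop
  | nil : Rewr R none [] []
  | cons (a : A) {u v : List A} : Rewr R none u v → Rewr R none (a :: u) (a :: v)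
  | rel {r s : Triple A} {u v x x' : List A} : Comp R r s → Rewr R none u (r.Z ++ x) →
      Rewr R (some r) x x' → Rewr R none (s.Z ++ x') v → Rewr R none (r.head ++ u) (s.head ++ v)
  | link_refl (r : Triple A) (x : List A) : Rewr R (some r) x x
  | link_tail {r k : Triple A} {x y y' : List A} : Rewr R (some r) x y → Comp R r k →
      Rewr R none (k.Z ++ y) (k.Z ++ y') → Rewr R (some r) x y'

/-- The relation on words that is defined by `Rewr` and agrees with `≡` under the condition `C(4)`. -/
abbrev Eqv (R : Set (List A × List A)) : List A → List A → Prop := Rewr R none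

/-- The relation, defined by `Rewr`, between words that can follow complements of `r`. -/
abbrev Link (R : Set (List A × List A)) (r : Triple A) : List A → List A → Prop := Rewr R (some r)

/-- `U` and `W` are related by rewriting a relation word that begins both of them. -/
def HeadRel (R : Set (List A × List A)) (U W : List A) : Prop :=
  ∃ r s u v x x', Comp R r s ∧ U = r.head ++ u ∧ W = s.head ++ v ∧ Eqv R u (r.Z ++ x) ∧
    Link R r x x' ∧ Eqv R (s.Z ++ x') v

theorem HeadRel.eqv {U W : List A} (h : HeadRel R U W) : Eqv R U W := by
  obtain ⟨r, s, u, v, x, x', h, rfl, rfl, h₁, h₂, h₃⟩ := h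
  exact .rel h h₁ h₂ h₃

namespace Eqv

theorem refl : ∀ u : List A, Eqv R u u
  | [] => .nil
  | a :: u => .cons a (refl u)

theorem append_left : ∀ (p : List A) {u v : List A}, Eqv R u v → Eqv R (p ++ u) (p ++ v)
  | [], _, _, h => h
  | a :: p, _, _, h => .cons a (append_left p h)

theorem nil_left {w : List A} (h : Eqv R [] w) : w = [] := by
  generalize hU : ([] : List A) = U at h
  cases h with
  | nil => rfl
  | cons => cases hU
  | rel h => exact absurd (List.append_eq_nil_iff.1 hU.symm).1 h.1.head_ne_nil

theorem cons_inv {a : A} {u w : List A} (h : Eqv R (a :: u) w) :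
    (∃ v, w = a :: v ∧ Eqv R u v) ∨ HeadRel R (a :: u) w := by
  generalize hU : a :: u = U at h
  cases h with
  | nil => cases hU
  | cons b h => cases hU; exact Or.inl ⟨_, rfl, h⟩
  | rel h h₁ h₂ h₃ => exact Or.inr ⟨_, _, _, _, _, _, h, rfl, rfl, h₁, h₂, h₃⟩

/-- A word related to `pu` either begins with `p`, or a relation word that starts inside `p` has
been rewritten. -/
theorem append_inv : ∀ {p u w : List A}, Eqv R (p ++ u) w →
    (∃ u', w = p ++ u' ∧ Eqv R u u') ∨
    ∃ a z w₀, p = a ++ z ∧ z ≠ [] ∧ w = a ++ w₀ ∧ HeadRel R (z ++ u) w₀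
  | [], _, w, h => Or.inl ⟨w, rfl, h⟩
  | b :: p, u, w, h => by
    rcases cons_inv h with ⟨v, rfl, hv⟩ | h
    · rcases append_inv hv with ⟨u', rfl, h'⟩ | ⟨a, z, w₀, rfl, hz, rfl, h'⟩
      · exact Or.inl ⟨u', rfl, h'⟩
      · exact Or.inr ⟨b :: a, z, w₀, rfl, hz, rfl, h'⟩
    · exact Or.inr ⟨[], b :: p, w, rfl, by simp, rfl, h⟩

end Eqv

namespace Link

variable {r s k : Triple A} {x y z : List A}

theorem trans (h : Link R r x y) (h' : Link R r y z) : Link R r x z := by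
  change Rewr R (some r) y z at h'
  generalize ho : some r = o at h'
  induction h' with
  | nil => cases ho
  | cons => cases ho
  | rel => cases ho
  | link_refl => exact h
  | link_tail _ hk hE ih => cases ho; exact .link_tail (ih h rfl) hk hE

theorem single (hk : Comp R r k) (h : Eqv R (k.Z ++ x) (k.Z ++ y)) : Link R r x y :=
  .link_tail (.link_refl _ _) hk h

theorem of_eqv (hr : IsFact R r) (h : Eqv R x y) : Link R r x y :=
  single (.refl hr) (h.append_left _)

theorem congr (hrs : Comp R r s) (h : Link R r x y) : Link R s x y := by
  change Rewr R (some r) x y at h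
  generalize ho : some r = o at h
  induction h with
  | nil => cases ho
  | cons => cases ho
  | rel => cases ho
  | link_refl => exact .link_refl _ _
  | link_tail _ hk hE ih => cases ho; exact .link_tail (ih rfl) (hrs.symm.trans hk) hE

end Link

theorem Rewr.symm {o : Option (Triple A)} {u v : List A} (h : Rewr R o u v) : Rewr R o v u := by
  induction h with
  | nil => exact .nil
  | cons a _ ih => exact .cons a ih
  | rel hc _ _ _ ih₁ ih₂ ih₃ => exact .rel hc.symm ih₃ (Link.congr hc ih₂) ih₁
  | link_refl => exact .link_refl _ _
  | link_tail _ hk _ ih₁ ih₂ => exact (Link.single hk ih₂).trans ih₁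

theorem HeadRel.symm {U W : List A} (h : HeadRel R U W) : HeadRel R W U := by
  obtain ⟨r, s, u, v, x, x', h, rfl, rfl, h₁, h₂, h₃⟩ := h
  exact ⟨s, r, v, u, x', x, h.symm, rfl, rfl, Rewr.symm h₃, (Link.congr h h₂.symm), Rewr.symm h₁⟩

/-- The heart of the matter. If `u` can be rewritten to begin with `Z`, so that `XYu` can be
rewritten to begin with the relation word `XYZ`, then no prefix `X'Y'` starts inside `XY`: its
middle word or that of `XYZ` would have to be a piece. -/
theorem not_head_inside {r s : Triple A} (hr : IsFact R r) (hs : IsFact R s) {c y u q x : List A}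
    (hc : c ≠ []) (hy : y ≠ []) (hcy : r.head = c ++ y) (h : y ++ u = s.head ++ q) :
    ¬ Eqv R u (r.Z ++ x) := by
  intro hE
  -- `X'Y'` cannot occur in `XYZ` after its beginning
  have key : ∀ m, r.word ≠ c ++ s.head ++ m := fun m hm => by
    obtain ⟨rfl, h'⟩ := hr.eq_of_middle hs (c := c ++ s.X) (t := m) (by simp [hm, Triple.head])
    simp_all
  have hw : r.word = c ++ y ++ r.Z := by rw [Triple.word_eq, hcy]
  rcases List.append_eq_append_iff.1 h with ⟨b, hb, rfl⟩ | ⟨b, rfl, -⟩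
  swap
  · exact key (b ++ r.Z) (by simp [hw])
  -- `Z` is the longest piece at the end of `XYZ`, so `yZ` does not begin `X'Y'`
  have key₂ : ∀ m, b ≠ r.Z ++ m := fun m hm => by
    have hp : IsPiece R (y ++ r.Z) := hr.piece_of_two hs (c := c) (t := []) (d := [])
      (e := m ++ s.Z) (by simp [hw]) (by simp [Triple.word_eq, hb, hm]) hc
    have := hr.maxZ c (y ++ r.Z) (by simp [hw]) hp
    simp_all
  rcases hE.append_inv with ⟨u', hu', -⟩ | ⟨b₁, b₂, w₀, rfl, -, hw₀, hH⟩
  · rcases List.append_eq_append_iff.1 hu' with ⟨m, h₁, -⟩ | ⟨m, h₁, -⟩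
    · exact key₂ m h₁
    · exact key m (by simp [hw, h₁, hb])
  · rcases List.append_eq_append_iff.1 hw₀ with ⟨m, rfl, -⟩ | ⟨m, h₁, -⟩
    · exact key₂ (m ++ b₂) (by simp)
    · have hp : IsPiece R (y ++ b₁) := hr.piece_of_two hs (c := c) (t := m) (d := [])
        (e := b₂ ++ s.Z) (by simp [hw, h₁]) (by simp [Triple.word_eq, hb]) hc
      obtain ⟨n, hn, hb₂⟩ := hs.prefix_X hp (x := b₂) (q := []) (by simp [hb])
      obtain ⟨k, _, v, _, _, _, hk, e, -⟩ := hH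
      rw [hb₂] at e
      have e' : (n ++ s.Y) ++ q = k.head ++ v := by simpa using e
      rcases List.append_eq_append_iff.1 e' with ⟨d, h₂, -⟩ | ⟨d, h₂, -⟩
      · obtain ⟨rfl, h₃⟩ := hk.1.eq_of_middle hs (c := n) (t := d ++ k.Z)
          (by simp [Triple.word_eq, h₂])
        rw [← h₃] at hn
        have := congrArg List.length hn
        simp only [List.length_append] at this
        exact hy (List.length_eq_zero_iff.1 (by omega))
      · obtain ⟨rfl, h₃⟩ := hs.eq_of_middle hk.1 (c := y ++ b₁ ++ k.X) (t := d ++ s.Z) (by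
          have : s.word = y ++ b₁ ++ (n ++ s.Y) ++ s.Z := by simp [Triple.word, hn]
          rw [this, h₂]; simp [Triple.head])
        have := congrArg List.length h₃
        simp only [List.length_append] at this
        exact hy (List.length_eq_zero_iff.1 (by omega))

/-- If a word begins with `XY` in a rewritable way, then rewriting inside of it, but not at its
beginning, leaves `XY` unchanged. -/
theorem Eqv.head_inv {r : Triple A} (hr : IsFact R r) {v x w : List A} {a : A} {t : List A}
    (hv : Eqv R v (r.Z ++ x)) (e : a :: t = r.head ++ v) (h : Eqv R t w) :
    ∃ v', a :: w = r.head ++ v' ∧ Eqv R v v' := by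
  obtain ⟨b, t', hh⟩ := List.exists_cons_of_ne_nil hr.head_ne_nil
  rw [hh] at e ⊢
  obtain ⟨rfl, rfl⟩ := List.cons.inj e
  rcases h.append_inv with ⟨v', rfl, h'⟩ | ⟨c, y, w₀, rfl, hy, -, hH⟩
  · exact ⟨v', rfl, h'⟩
  · obtain ⟨s, _, q, _, _, _, hs, e, -⟩ := hH
    exact absurd hv (not_head_inside hr hs.1 (c := a :: c) (by simp) hy (by simpa using hh) e)

/-- The proof is by induction on the length of the middle word, which begins with heads on the one
side, on the other, or on both. By `Eqv.head_inv` a head on one side survives on the other side, and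
by `IsFact.head_unique` two heads at the beginning of a word are the same. -/
theorem Eqv.trans {w₁ w₂ w₃ : List A} (h : Eqv R w₁ w₂) (h' : Eqv R w₂ w₃) : Eqv R w₁ w₃ := by
  induction hn : w₂.length using Nat.strong_induction_on generalizing w₁ w₂ w₃ with
  | _ n ih =>
  subst hn
  rcases w₂ with _ | ⟨a, t⟩
  · rw [Eqv.nil_left h', Eqv.nil_left h.symm]
    exact .nil
  have lt : ∀ {s : Triple A} {u}, IsFact R s → a :: t = s.head ++ u →
      u.length < (a :: t).length := fun hs e => by
    rw [e, List.length_append]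
    have := List.length_pos_iff.2 hs.head_ne_nil
    omega
  rcases Eqv.cons_inv h.symm with ⟨v, rfl, hv⟩ | H
  · rcases Eqv.cons_inv h' with ⟨v', rfl, hv'⟩ | H'
    · exact .cons a (ih _ (by simp) hv.symm hv' rfl)
    · obtain ⟨r, s, u, v', x, x', hc, e, rfl, h₁, h₂, h₃⟩ := H'
      obtain ⟨u', e', hu⟩ := Eqv.head_inv hc.1 h₁ e hv
      rw [e']
      exact .rel hc (ih _ (lt hc.1 e) hu.symm h₁ rfl) h₂ h₃
  · obtain ⟨r, s, u, v, x, x', hc, e, rfl, h₁, h₂, h₃⟩ := H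
    rcases Eqv.cons_inv h' with ⟨v', rfl, hv'⟩ | H'
    · obtain ⟨u', e', hu⟩ := Eqv.head_inv hc.1 h₁ e hv'
      rw [e']
      exact .rel hc.symm h₃.symm (Link.congr hc (Rewr.symm h₂)) (ih _ (lt hc.1 e) h₁.symm hu rfl)
    · obtain ⟨r', s', u', v', y, y', hc', e', rfl, h₁', h₂', h₃'⟩ := H'
      obtain ⟨rfl, rfl⟩ := hc.1.head_unique hc'.1 (e.symm.trans e')
      have hm : Eqv R (r.Z ++ x) (r.Z ++ y) := ih _ (lt hc.1 e) h₁.symm h₁' rfl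
      exact .rel (hc.symm.trans hc') h₃.symm
        (Link.congr hc (Link.trans (Link.trans (Rewr.symm h₂) (Link.single (.refl hc.1) hm)) h₂')) h₃'

/-! ### Agreement with the equivalence generated by the relations -/

theorem Equivalent.append {u v : List A} (h : Equivalent R u v) (a b : List A) :
    Equivalent R (a ++ u ++ b) (a ++ v ++ b) := by
  refine Relation.ReflTransGen.lift (fun w => a ++ w ++ b) ?_ _ _ h
  rintro _ _ ⟨c, d, x, y, hxy, rfl, rfl⟩
  exact ⟨a ++ c, d ++ b, x, y, hxy, by simp, by simp⟩

theorem Equivalent.of_eqvGen {x y : List A} (h : Relation.EqvGen (fun x y => (x, y) ∈ R) x y) :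
    Equivalent R x y ∧ Equivalent R y x := by
  induction h with
  | rel x y h =>
    exact ⟨.single ⟨[], [], x, y, Or.inl h, by simp, by simp⟩,
      .single ⟨[], [], y, x, Or.inr h, by simp, by simp⟩⟩
  | refl => exact ⟨.refl, .refl⟩
  | symm _ _ _ ih => exact ih.symm
  | trans _ _ _ _ _ ih₁ ih₂ => exact ⟨ih₁.1.trans ih₂.1, ih₂.2.trans ih₁.2⟩

theorem Comp.equivalent {r s : Triple A} (h : Comp R r s) (x : List A) :
    Equivalent R (r.word ++ x) (s.word ++ x) := by
  simpa using (Equivalent.of_eqvGen h.2.2).1.append [] x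

theorem Eqv.equivalent {u v : List A} (h : Eqv R u v) : Equivalent R u v := by
  suffices H : ∀ o u v, Rewr R o u v →
      o.elim (Equivalent R u v)
        fun r => IsFact R r → Equivalent R (r.word ++ u) (r.word ++ v) from H none u v h
  intro o u v h
  induction h with
  | nil => exact .refl
  | cons a _ ih => simpa using Equivalent.append ih [a] []
  | @rel r s u v x x' hc _ _ _ ih₁ ih₂ ih₃ =>
    have h₁ := Equivalent.append ih₁ r.head []
    have h₂ := ih₂ hc.1
    have h₃ := Equivalent.append ih₃ s.head []
    simp only [List.append_nil, ← List.append_assoc, ← Triple.word_eq] at h₁ h₃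
    exact ((h₁.trans h₂).trans (hc.equivalent x')).trans h₃
  | link_refl => exact fun _ => .refl
  | @link_tail r k x y y' _ hk _ ih₁ ih₂ =>
    intro hr
    have h₁ := Equivalent.append ih₂ k.head []
    simp only [List.append_nil, ← List.append_assoc, ← Triple.word_eq] at h₁
    exact (((ih₁ hr).trans (hk.equivalent y)).trans h₁).trans (hk.symm.equivalent y')

theorem OneStep.eqv (hC : SatisfiesC 4 R) {u v : List A} (h : OneStep R u v) : Eqv R u v := by
  obtain ⟨a, b, x, y, hxy, rfl, rfl⟩ := h
  obtain ⟨r, hr, rfl⟩ := exists_isFact hC (w := x) ⟨y, hxy⟩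
  obtain ⟨s, hs, rfl⟩ := exists_isFact hC (w := y) ⟨r.word, hxy.symm⟩
  have hc : Comp R r s := ⟨hr, hs, hxy.elim (fun h => .rel _ _ h) fun h => .symm _ _ (.rel _ _ h)⟩
  have := Eqv.append_left a (.rel hc (Eqv.refl (r.Z ++ b)) (.link_refl _ _) (Eqv.refl (s.Z ++ b)))
  simpa [Triple.word_eq] using this

theorem equivalent_iff_eqv (hC : SatisfiesC 4 R) {u v : List A} :
    Equivalent R u v ↔ Eqv R u v := by
  refine ⟨fun h => ?_, Eqv.equivalent⟩
  induction h with
  | refl => exact .refl u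
  | tail _ h ih => exact ih.trans (h.eqv hC)

end Theory

section Theory

variable {A : Type*} {R : Set (List A × List A)}

/-! ### Clean heads -/

/-- `U = XYu`, and no other prefix `X'Y'` starts inside the displayed `XY`. -/
structure CleanHead (R : Set (List A × List A)) (r : Triple A) (U u : List A) : Prop where
  fact : IsFact R r
  eq : U = r.head ++ u
  clean : ∀ s c y q, IsFact R s → c ≠ [] → y ≠ [] → r.head = c ++ y → y ++ u ≠ s.head ++ q

/-- The relation between `u` and `v` that is needed to rewrite `XYu` to `X'Y'v` at its head. -/
def Joined (R : Set (List A × List A)) (r s : Triple A) (u v : List A) : Prop :=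
  ∃ x x', Eqv R u (r.Z ++ x) ∧ Link R r x x' ∧ Eqv R (s.Z ++ x') v

/-- The piece `z` and the word `x` together begin with a word `XY`, and what follows can be rewritten
to begin with `Z`. -/
def Active (R : Set (List A × List A)) (z x : List A) : Prop :=
  ∃ r q x', IsFact R r ∧ z ++ x = r.head ++ q ∧ Eqv R q (r.Z ++ x')

variable {r s k : Triple A} {u v w U V W x y z p : List A}

theorem IsFact.cleanHead (hr : IsFact R r) (h : Eqv R u (r.Z ++ x)) :
    CleanHead R r (r.head ++ u) u :=
  ⟨hr, rfl, fun _ _ _ _ hs hc hy e e' => not_head_inside hr hs hc hy e e' h⟩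

theorem Joined.symm (hc : Comp R r s) (h : Joined R r s u v) : Joined R s r v u := by
  obtain ⟨x, x', h₁, h₂, h₃⟩ := h
  exact ⟨x', x, Rewr.symm h₃, Link.congr hc (Rewr.symm h₂), Rewr.symm h₁⟩

theorem Joined.eqv (hc : Comp R r s) (h : Joined R r s u v) :
    Eqv R (r.head ++ u) (s.head ++ v) := by
  obtain ⟨x, x', h₁, h₂, h₃⟩ := h
  exact .rel hc h₁ h₂ h₃

theorem HeadRel.exists_cleanHead (h : HeadRel R U W) : ∃ r u, CleanHead R r U u := by
  obtain ⟨r, s, u, v, x, x', hc, rfl, rfl, h₁, -⟩ := h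
  exact ⟨r, u, hc.1.cleanHead h₁⟩

/-- A clean head is preserved, or it is replaced by the head of a complement. -/
theorem CleanHead.inv (h : CleanHead R r U u) (hE : Eqv R U W) :
    (∃ w, W = r.head ++ w ∧ Eqv R u w) ∨
      ∃ s w, Comp R r s ∧ W = s.head ++ w ∧ Joined R r s u w := by
  obtain ⟨hr, rfl, hcl⟩ := h
  rcases hE.append_inv with h | ⟨c, y, w₀, e, hy, rfl, r', s', u', v', x, x', hc, e', rfl, h₁, h₂, h₃⟩
  · exact Or.inl h
  · rcases eq_or_ne c [] with rfl | hc'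
    · rw [List.nil_append] at e
      rw [← e] at e'
      obtain ⟨rfl, rfl⟩ := hr.head_unique hc.1 e'
      exact Or.inr ⟨s', v', hc, rfl, x, x', h₁, h₂, h₃⟩
    · exact absurd e' (hcl _ _ _ _ hc.1 hc' hy e)

theorem HeadRel.active {u : List A} (h : HeadRel R (z ++ u) W) : Active R z u := by
  obtain ⟨r, s, q, v, x, x', hc, e, -, h₁, -⟩ := h
  exact ⟨r, q, x, hc.1, e, h₁⟩

/-- If a word related to `pu` does not begin with `p`, then some suffix of `p` makes `u` active. -/
theorem Eqv.active_of_not_prefix (h : Eqv R (p ++ u) w) (hp : ¬ p <+: w) :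
    ∃ a z w₀, p = a ++ z ∧ z ≠ [] ∧ w = a ++ w₀ ∧ Active R z u ∧ Eqv R (z ++ u) w₀ := by
  rcases h.append_inv with ⟨u', rfl, -⟩ | ⟨a, z, w₀, e, hz, e', h⟩
  · exact absurd (List.prefix_append _ _) hp
  · exact ⟨a, z, w₀, e, hz, e', h.active, h.eqv⟩

theorem Eqv.cancel_or_active (h : Eqv R (p ++ u) (p ++ v)) :
    Eqv R u v ∨ ∃ a z, p = a ++ z ∧ Active R z u ∧ Active R z v ∧ Eqv R (z ++ u) (z ++ v) := by
  rcases h.append_inv with ⟨u', e, h⟩ | ⟨a, z, w₀, rfl, hz, e, h⟩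
  · obtain rfl := List.append_cancel_left e
    exact Or.inl h
  · obtain rfl : z ++ v = w₀ := by simpa using e
    exact Or.inr ⟨a, z, rfl, h.active, h.symm.active, h.eqv⟩

/-- Whether a word is active after `z` depends on the class of `zx` only. -/
theorem Active.congr (h : Active R z x) (hE : Eqv R (z ++ x) (z ++ y)) : Active R z y := by
  obtain ⟨r, q, x', hr, e, hq⟩ := h
  rw [e] at hE
  rcases (hr.cleanHead hq).inv hE with ⟨w, e', hw⟩ | ⟨s, w, hc, e', x₁, x₂, -, -, h⟩
  · exact ⟨r, w, x', hr, e', Eqv.trans (Rewr.symm hw) hq⟩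
  · exact ⟨s, w, x₂, hc.2.1, e', Rewr.symm h⟩

theorem Active.unique (hz : IsPiece R z) (hw : IsPiece R w) (h : Active R z x)
    (h' : Active R w x) : z = w := by
  obtain ⟨r, q, _, hr, e, -⟩ := h
  obtain ⟨s, q', _, hs, e', -⟩ := h'
  exact hr.piece_unique hs hz hw e e'

/-- Linked words are related, or both are active after one and the same piece. -/
theorem Link.eqv_or_active (h : Link R r x y) :
    Eqv R x y ∨ ∃ k a z, Comp R r k ∧ k.Z = a ++ z ∧ Active R z x ∧ Active R z y ∧
      Eqv R (z ++ x) (z ++ y) := by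
  change Rewr R (some r) x y at h
  generalize ho : some r = o at h
  induction h with
  | nil => cases ho
  | cons => cases ho
  | rel => cases ho
  | link_refl => exact Or.inl (Eqv.refl _)
  | @link_tail _ k x y y' _ hk hE ih =>
    cases ho
    rcases Eqv.cancel_or_active hE with h | ⟨a, z, e, h₁, h₂, h₃⟩
    · rcases ih rfl with h' | ⟨k', a', z', hk', e', h₁', h₂', h₃'⟩
      · exact Or.inl (Eqv.trans h' h)
      · have := Eqv.append_left z' h
        exact Or.inr ⟨k', a', z', hk', e', h₁', h₂'.congr this, Eqv.trans h₃' this⟩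
    · rcases ih rfl with h' | ⟨k', a', z', hk', e', h₁', h₂', h₃'⟩
      · have := Eqv.append_left z h'
        exact Or.inr ⟨k, a, z, hk, e, h₁.congr (Rewr.symm this), h₂, Eqv.trans this h₃⟩
      · have p₁ : IsPiece R z := (e ▸ hk.2.1.pieceZ).of_suffix
        have p₂ : IsPiece R z' := (e' ▸ hk'.2.1.pieceZ).of_suffix
        obtain rfl := Active.unique p₁ p₂ h₁ h₂'
        exact Or.inr ⟨k, a, z, hk, e, h₁', h₂, Eqv.trans h₃' h₃⟩

/-- The piece after which a word is active is unique, so it is the one through which the word is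
linked. -/
theorem Link.eqv_of_active (h : Link R r x y) (hz : IsPiece R z) (ha : Active R z x) :
    Eqv R (z ++ x) (z ++ y) := by
  rcases h.eqv_or_active with h | ⟨k, a, z', hk, e, h₁, -, h₃⟩
  · exact h.append_left z
  · obtain rfl := Active.unique hz (e ▸ hk.2.1.pieceZ).of_suffix ha h₁
    exact h₃

/-! ### Reducing the comparison of two words -/

/-- The condition decided by the automaton: `U ≡ V`, and these words can be rewritten to begin
with `p`. -/
def Holds (R : Set (List A × List A)) (U V p : List A) : Prop :=
  Eqv R U V ∧ ∃ x, Eqv R U (p ++ x)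

theorem Holds.nil_right : Holds R U V [] ↔ Eqv R U V :=
  ⟨fun h => h.1, fun h => ⟨h, U, Eqv.refl U⟩⟩

theorem holds_nil_left : Holds R [] V p ↔ V = [] ∧ p = [] := by
  constructor
  · rintro ⟨h, x, h'⟩
    exact ⟨h.nil_left, (List.append_eq_nil_iff.1 h'.nil_left).1⟩
  · rintro ⟨rfl, rfl⟩
    exact ⟨.nil, [], .nil⟩

theorem holds_nil_middle : Holds R U [] p ↔ U = [] ∧ p = [] := by
  constructor
  · intro h
    obtain rfl := Eqv.nil_left (Rewr.symm h.1)
    exact ⟨rfl, (holds_nil_left.1 h).2⟩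
  · rintro ⟨rfl, rfl⟩
    exact holds_nil_left.2 ⟨rfl, rfl⟩

/-- Without clean heads on both sides, first letters can only be compared and deleted. -/
theorem holds_cons {a b : A}
    (hn : (¬ ∃ r u, CleanHead R r (a :: U) u) ∨ ¬ ∃ r u, CleanHead R r (b :: V) u) :
    Holds R (a :: U) (b :: V) p ↔ a = b ∧ (p = [] ∨ p.head? = some a) ∧ Holds R U V p.tail := by
  constructor
  · rintro ⟨h, x, hx⟩
    have h₁ : ∃ v, b :: V = a :: v ∧ Eqv R U v := by
      rcases Eqv.cons_inv h with h | h
      · exact h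
      · exact (hn.elim (fun hn => hn h.exists_cleanHead)
          fun hn => hn h.symm.exists_cleanHead).elim
    obtain ⟨v, e, hv⟩ := h₁
    obtain ⟨rfl, rfl⟩ := List.cons.inj e
    refine ⟨rfl, ?_⟩
    rcases p with _ | ⟨c, p⟩
    · exact ⟨Or.inl rfl, hv, U, Eqv.refl U⟩
    · rcases hn with hn | hn
      · rcases Eqv.cons_inv hx with ⟨w, e, h⟩ | h
        · obtain ⟨rfl, rfl⟩ := List.cons.inj e
          exact ⟨Or.inr rfl, hv, x, h⟩
        · exact absurd h.exists_cleanHead hn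
      · rcases Eqv.cons_inv (Eqv.trans (Rewr.symm h) hx) with ⟨w, e, h⟩ | h
        · obtain ⟨rfl, rfl⟩ := List.cons.inj e
          exact ⟨Or.inr rfl, hv, x, Eqv.trans hv h⟩
        · exact absurd h.exists_cleanHead hn
  · rintro ⟨rfl, hp, h, x, hx⟩
    refine ⟨.cons a h, ?_⟩
    rcases p with _ | ⟨c, p⟩
    · exact ⟨a :: U, Eqv.refl _⟩
    · obtain rfl : c = a := by simpa using hp
      exact ⟨x, .cons c hx⟩

/-- For `p` to be promised to `XYu`, it must begin some complement of `XYZ`. -/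
theorem Holds.comp (hp : IsPiece R p) (hU : CleanHead R r U u) (hV : CleanHead R s V v)
    (h : Holds R U V p) : Comp R r s ∧ ∃ k, Comp R r k ∧ p <+: k.X := by
  obtain ⟨h, x, hx⟩ := h
  constructor
  · rcases hU.inv h with ⟨w, e, -⟩ | ⟨s', w, hc, e, -⟩
    · obtain ⟨rfl, -⟩ := hU.fact.head_unique hV.fact (e.symm.trans hV.eq)
      exact .refl hU.fact
    · obtain ⟨rfl, -⟩ := hc.2.1.head_unique hV.fact (e.symm.trans hV.eq)
      exact hc
  · rcases hU.inv hx with ⟨w, e, -⟩ | ⟨k, w, hc, e, -⟩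
    · obtain ⟨m, e, -⟩ := hU.fact.prefix_X hp e
      exact ⟨r, .refl hU.fact, m, e.symm⟩
    · obtain ⟨m, e, -⟩ := hc.2.1.prefix_X hp e
      exact ⟨k, hc, m, e.symm⟩

/-- Equal heads that agree with the promise need not be rewritten. -/
theorem holds_of_same_head (hU : CleanHead R r U u) (hV : CleanHead R r V v) (hp : p <+: r.X) :
    Holds R U V p ↔ Eqv R u v ∨ Joined R r r u v := by
  constructor
  · rintro ⟨h, -⟩
    rcases hU.inv h with ⟨w, e, h⟩ | ⟨s, w, hc, e, h⟩
    · obtain ⟨-, rfl⟩ := hU.fact.head_unique hU.fact (e.symm.trans hV.eq)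
      exact Or.inl h
    · obtain ⟨rfl, rfl⟩ := hc.2.1.head_unique hV.fact (e.symm.trans hV.eq)
      exact Or.inr h
  · intro h
    obtain ⟨m, hm⟩ := hp
    refine ⟨?_, m ++ r.Y ++ u, ?_⟩
    · rw [hU.eq, hV.eq]
      exact h.elim (Eqv.append_left _) (Joined.eqv (.refl hU.fact))
    · rw [hU.eq, Triple.head, ← hm]
      simpa using Eqv.refl _

/-- If the heads differ, or if they do not agree with the promise, they have to be rewritten. -/
theorem holds_of_ne_head (hU : CleanHead R r U u) (hV : CleanHead R s V v) (hc : Comp R r s)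
    (hp : IsPiece R p) (hk : ∃ k, Comp R r k ∧ p <+: k.X) (hne : ¬ (r = s ∧ p <+: r.X)) :
    Holds R U V p ↔ Joined R r s u v := by
  constructor
  · rintro ⟨h, x, hx⟩
    rcases hU.inv h with ⟨w, e, h⟩ | ⟨s', w, hc, e, h⟩
    · obtain ⟨rfl, rfl⟩ := hU.fact.head_unique hV.fact (e.symm.trans hV.eq)
      rcases hU.inv hx with ⟨w', e', -⟩ | ⟨k, w', hk, e', y, y', h', -⟩
      · obtain ⟨m, hm, -⟩ := hU.fact.prefix_X hp e'
        exact absurd ⟨rfl, m, hm.symm⟩ hne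
      · exact ⟨y, y, h', .link_refl _ _, Eqv.trans (Rewr.symm h') h⟩
    · obtain ⟨rfl, rfl⟩ := hc.2.1.head_unique hV.fact (e.symm.trans hV.eq)
      exact h
  · intro h
    refine ⟨?_, ?_⟩
    · rw [hU.eq, hV.eq]
      exact h.eqv hc
    · obtain ⟨k, hk, m, hm⟩ := hk
      obtain ⟨y, -, h₁, -⟩ := h
      refine ⟨m ++ k.Y ++ (k.Z ++ y), ?_⟩
      have : Eqv R (r.head ++ u) (k.head ++ (k.Z ++ y)) :=
        .rel hk h₁ (.link_refl _ _) (Eqv.refl _)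
      rw [hU.eq]
      rw [Triple.head, Triple.head, ← hm] at this
      simpa [Triple.head] using this

/-! ### Deciding whether two words are joined -/

theorem joined_prefix_iff (hc : Comp R r s) :
    Joined R r s (r.Z ++ x) (s.Z ++ y) ↔ Link R r x y := by
  constructor
  · rintro ⟨x', y', h₁, h₂, h₃⟩
    exact Link.trans (Link.trans (Link.single (.refl hc.1) h₁) h₂) (Link.single hc h₃)
  · exact fun h => ⟨x, y, Eqv.refl _, h, Eqv.refl _⟩

/-- The words `x` that are active after a suffix of `Z` are linked with others through `Z` only. It
suffices to see that `x` begins with the right prefix `XY`, whether or not that can be rewritten. -/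
theorem link_iff_of_active_prefix (hk : Comp R r k) {a q : List A} {t : Triple A}
    (ha : k.Z = a ++ z) (ht : IsFact R t) (e : z ++ x = t.head ++ q) :
    Link R r x y ↔ Eqv R (k.Z ++ x) (k.Z ++ y) := by
  refine ⟨fun h => ?_, Link.single hk⟩
  rcases h.eqv_or_active with h | ⟨k', a', z', hk', e', ⟨r', q', _, hr', h₁, -⟩, -, h₃⟩
  · exact h.append_left _
  · obtain rfl := ht.piece_unique hr' (ha ▸ hk.2.1.pieceZ).of_suffix
      (e' ▸ hk'.2.1.pieceZ).of_suffix e h₁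
    rw [ha, List.append_assoc, List.append_assoc]
    exact h₃.append_left a

theorem link_iff_of_no_active_prefix (hr : IsFact R r)
    (hn : ∀ k a z t q, Comp R r k → k.Z = a ++ z → IsFact R t → z ++ x ≠ t.head ++ q) :
    Link R r x y ↔ Eqv R x y := by
  refine ⟨fun h => ?_, Link.of_eqv hr⟩
  rcases h.eqv_or_active with h | ⟨k, a, z, hk, e, ⟨t, q, _, ht, h₁, -⟩, -⟩
  · exact h
  · exact absurd h₁ (hn k a z t q hk e ht)

/-- If `v` does not begin with `Z'`, then `Z'x'` is rewritten at a head that starts inside `Z'`; so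
`x'` is active, and `x` can be replaced by any word linked with it. -/
theorem Joined.eqv_prefix (h : Joined R r s (r.Z ++ x) v) (hc : Comp R r s)
    (hv : ¬ s.Z <+: v) : Eqv R (s.Z ++ x) v := by
  obtain ⟨x₁, x₂, h₁, h₂, h₃⟩ := h
  obtain ⟨a, z, w, e, -, -, ha, -⟩ := h₃.active_of_not_prefix hv
  have hl : Link R r x₂ x :=
    Link.trans (Rewr.symm h₂) (Rewr.symm (Link.single (.refl hc.1) h₁))
  have := Link.eqv_of_active hl (e ▸ hc.2.1.pieceZ).of_suffix ha
  refine Eqv.trans ?_ h₃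
  rw [e, List.append_assoc, List.append_assoc]
  exact Eqv.append_left a (Rewr.symm this)

theorem joined_prefix_left_iff (hc : Comp R r s) (hv : ¬ s.Z <+: v) :
    Joined R r s (r.Z ++ x) v ↔ Eqv R (s.Z ++ x) v :=
  ⟨fun h => h.eqv_prefix hc hv, fun h => ⟨x, x, Eqv.refl _, .link_refl _ _, h⟩⟩

theorem joined_prefix_right_iff (hc : Comp R r s) (hu : ¬ r.Z <+: u) :
    Joined R r s u (s.Z ++ y) ↔ Eqv R u (r.Z ++ y) :=
  ⟨fun h => Rewr.symm ((h.symm hc).eqv_prefix hc.symm hu),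
    fun h => ⟨y, y, h, .link_refl _ _, Eqv.refl _⟩⟩

theorem Joined.eqv_of_not_prefix (hr : IsFact R r) (h : Joined R r r u v)
    (hn : ¬ (r.Z <+: u ∧ r.Z <+: v)) : Eqv R u v := by
  wlog hv : ¬ r.Z <+: v generalizing u v
  · exact Rewr.symm (this (h.symm (.refl hr)) (fun h' => hn h'.symm)
      fun h' => hn ⟨h', not_not.1 hv⟩)
  obtain ⟨x₁, x₂, h₁, h₂, h₃⟩ := h
  exact Eqv.trans h₁
    (Joined.eqv_prefix ⟨x₁, x₂, Eqv.refl _, h₂, h₃⟩ (.refl hr) hv)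

/-- If neither word begins with its `Z`, both `Z` are resolved within their longest common
suffix `z`, which remains as a promise. -/
theorem joined_iff_of_not_prefix (hc : Comp R r s) (hu : ¬ r.Z <+: u) (hv : ¬ s.Z <+: v)
    {a b : List A} (hr : r.Z = a ++ z) (hs : s.Z = b ++ z)
    (hz : ∀ z', z' <:+ r.Z → z' <:+ s.Z → z' <:+ z) :
    Joined R r s u v ↔ ∃ u' v', u = a ++ u' ∧ v = b ++ v' ∧ Holds R u' v' z := by
  constructor
  · rintro ⟨x₁, x₂, h₁, h₂, h₃⟩
    obtain ⟨a', z₁, u₀, e₁, -, rfl, ha₁, hE₁⟩ := Eqv.active_of_not_prefix (Rewr.symm h₁) hu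
    obtain ⟨b', z₂, v₀, e₂, -, rfl, ha₂, hE₂⟩ := Eqv.active_of_not_prefix h₃ hv
    have p₁ : IsPiece R z₁ := (e₁ ▸ hc.1.pieceZ).of_suffix
    have p₂ : IsPiece R z₂ := (e₂ ▸ hc.2.1.pieceZ).of_suffix
    have hE := Link.eqv_of_active h₂ p₁ ha₁
    obtain rfl := Active.unique p₁ p₂ (ha₁.congr hE) ha₂
    obtain ⟨c, rfl⟩ := hz z₁ ⟨a', e₁.symm⟩ ⟨b', e₂.symm⟩
    obtain rfl : a' = a ++ c := by
      rw [hr, ← List.append_assoc] at e₁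
      exact (List.append_cancel_right e₁).symm
    obtain rfl : b' = b ++ c := by
      rw [hs, ← List.append_assoc] at e₂
      exact (List.append_cancel_right e₂).symm
    refine ⟨c ++ u₀, c ++ v₀, by simp, by simp, Eqv.append_left c ?_, x₁, ?_⟩
    · exact Eqv.trans (Rewr.symm hE₁) (Eqv.trans hE hE₂)
    · rw [List.append_assoc]
      exact Eqv.append_left c (Rewr.symm hE₁)
  · rintro ⟨u', v', rfl, rfl, h, x, hx⟩
    refine ⟨x, x, ?_, .link_refl _ _, ?_⟩
    · rw [hr, List.append_assoc]
      exact hx.append_left a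
    · rw [hs, List.append_assoc]
      exact Eqv.append_left b (Eqv.trans (Rewr.symm hx) h)

end Theory

end SmallOverlap

/-! ### Composition rules for primitive recursive functions -/

section PrimrecRules

attribute [fun_prop] Primrec
attribute [fun_prop] Primrec.id Primrec.const Primrec.comp

variable {α β γ σ : Type*} [Primcodable α] [Primcodable β] [Primcodable γ] [Primcodable σ]

namespace SmallOverlap

@[fun_prop]
theorem primrec_fst {f : α → β × γ} (hf : Primrec f) : Primrec fun x => (f x).1 :=
  Primrec.fst.comp hf

@[fun_prop]
theorem primrec_snd {f : α → β × γ} (hf : Primrec f) : Primrec fun x => (f x).2 :=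
  Primrec.snd.comp hf

@[fun_prop]
theorem primrec_pair {f : α → β} {g : α → γ} (hf : Primrec f) (hg : Primrec g) :
    Primrec fun x => (f x, g x) :=
  hf.pair hg

@[fun_prop]
theorem primrec_append {f g : α → List β} (hf : Primrec f) (hg : Primrec g) :
    Primrec fun x => f x ++ g x :=
  Primrec.list_append.comp hf hg

@[fun_prop]
theorem primrec_cons {f : α → β} {g : α → List β} (hf : Primrec f) (hg : Primrec g) :
    Primrec fun x => f x :: g x :=
  Primrec.list_cons.comp hf hg

@[fun_prop]
theorem primrec_map {f : α → List β} {g : α → β → γ} (hf : Primrec f)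
    (hg : Primrec fun p : α × β => g p.1 p.2) : Primrec fun x => (f x).map (g x) :=
  Primrec.list_map hf hg

@[fun_prop]
theorem primrec_flatMap {f : α → List β} {g : α → β → List γ} (hf : Primrec f)
    (hg : Primrec fun p : α × β => g p.1 p.2) : Primrec fun x => (f x).flatMap (g x) :=
  Primrec.list_flatMap hf hg

@[fun_prop]
theorem primrec_foldr {f : α → List β} {g : α → σ} {h : α → β → σ → σ} (hf : Primrec f)
    (hg : Primrec g) (hh : Primrec fun p : α × β × σ => h p.1 p.2.1 p.2.2) :
    Primrec fun x => (f x).foldr (h x) (g x) :=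
  Primrec.list_foldr (h := fun x p => h x p.1 p.2) hf hg hh

@[fun_prop]
theorem primrec_flatten {f : α → List (List β)} (hf : Primrec f) :
    Primrec fun x => (f x).flatten :=
  Primrec.list_flatten.comp hf

@[fun_prop]
theorem primrec_take {f : α → ℕ} {g : α → List β} (hf : Primrec f) (hg : Primrec g) :
    Primrec fun x => (g x).take (f x) :=
  Primrec.list_take.comp hf hg

@[fun_prop]
theorem primrec_drop {f : α → ℕ} {g : α → List β} (hf : Primrec f) (hg : Primrec g) :
    Primrec fun x => (g x).drop (f x) :=
  Primrec.list_drop.comp hf hg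

@[fun_prop]
theorem primrec_length {f : α → List β} (hf : Primrec f) : Primrec fun x => (f x).length :=
  Primrec.list_length.comp hf

@[fun_prop]
theorem primrec_head? {f : α → List β} (hf : Primrec f) : Primrec fun x => (f x).head? :=
  Primrec.list_head?.comp hf

@[fun_prop]
theorem primrec_tail {f : α → List β} (hf : Primrec f) : Primrec fun x => (f x).tail :=
  Primrec.list_tail.comp hf

@[fun_prop]
theorem primrec_reverse {f : α → List β} (hf : Primrec f) : Primrec fun x => (f x).reverse :=
  Primrec.list_reverse.comp hf

@[fun_prop]
theorem primrec_range {f : α → ℕ} (hf : Primrec f) : Primrec fun x => List.range (f x) :=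
  Primrec.list_range.comp hf

@[fun_prop]
theorem primrec_add {f g : α → ℕ} (hf : Primrec f) (hg : Primrec g) :
    Primrec fun x => f x + g x :=
  Primrec.nat_add.comp hf hg

@[fun_prop]
theorem primrec_sub {f g : α → ℕ} (hf : Primrec f) (hg : Primrec g) :
    Primrec fun x => f x - g x :=
  Primrec.nat_sub.comp hf hg

@[fun_prop]
theorem primrec_mul {f g : α → ℕ} (hf : Primrec f) (hg : Primrec g) :
    Primrec fun x => f x * g x :=
  Primrec.nat_mul.comp hf hg

@[fun_prop]
theorem primrec_and {f g : α → Bool} (hf : Primrec f) (hg : Primrec g) :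
    Primrec fun x => f x && g x :=
  Primrec.and.comp hf hg

@[fun_prop]
theorem primrec_or {f g : α → Bool} (hf : Primrec f) (hg : Primrec g) :
    Primrec fun x => f x || g x :=
  Primrec.or.comp hf hg

@[fun_prop]
theorem primrec_not {f : α → Bool} (hf : Primrec f) : Primrec fun x => !f x :=
  Primrec.not.comp hf

@[fun_prop]
theorem primrec_decide_eq [DecidableEq β] {f g : α → β} (hf : Primrec f) (hg : Primrec g) :
    Primrec fun x => decide (f x = g x) :=
  Primrec.eq.decide.comp hf hg

@[fun_prop]
theorem primrec_decide_le {f g : α → ℕ} (hf : Primrec f) (hg : Primrec g) :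
    Primrec fun x => decide (f x ≤ g x) :=
  Primrec.nat_le.decide.comp hf hg

@[fun_prop]
theorem primrec_decide_lt {f g : α → ℕ} (hf : Primrec f) (hg : Primrec g) :
    Primrec fun x => decide (f x < g x) :=
  Primrec.nat_lt.decide.comp hf hg

@[fun_prop]
theorem primrec_cond {c : α → Bool} {f g : α → β} (hc : Primrec c) (hf : Primrec f)
    (hg : Primrec g) : Primrec fun x => bif c x then f x else g x :=
  Primrec.cond hc hf hg

@[fun_prop]
theorem primrec_some {f : α → β} (hf : Primrec f) : Primrec fun x => some (f x) :=
  Primrec.option_some.comp hf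

@[fun_prop]
theorem primrec_elim {o : α → Option β} {f : α → σ} {g : α → β → σ} (ho : Primrec o)
    (hf : Primrec f) (hg : Primrec fun p : α × β => g p.1 p.2) :
    Primrec fun x => (o x).elim (f x) (g x) :=
  (Primrec.option_casesOn (g := g) ho hf hg).of_eq fun x => by cases o x <;> rfl

@[fun_prop]
theorem primrec_bind {o : α → Option β} {g : α → β → Option σ} (ho : Primrec o)
    (hg : Primrec fun p : α × β => g p.1 p.2) : Primrec fun x => (o x).bind (g x) :=
  Primrec.option_bind (g := g) ho hg

@[fun_prop]
theorem primrec_toList {o : α → Option β} (ho : Primrec o) : Primrec fun x => (o x).toList :=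
  Primrec.optionToList.comp ho

@[fun_prop]
theorem primrec_iterate {f : α → ℕ} {g : α → β} {h : α → β → β} (hf : Primrec f)
    (hg : Primrec g) (hh : Primrec fun p : α × β => h p.1 p.2) :
    Primrec fun x => (h x)^[f x] (g x) :=
  Primrec.nat_iterate (h := h) hf hg hh

@[fun_prop]
theorem primrec_encode {f : α → β} (hf : Primrec f) : Primrec fun x => Encodable.encode (f x) :=
  Primrec.encode.comp hf

@[fun_prop]
theorem primrec_findIdx {f : α → List β} {p : α → β → Bool} (hf : Primrec f)
    (hp : Primrec fun q : α × β => p q.1 q.2) : Primrec fun x => (f x).findIdx (p x) :=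
  Primrec.list_findIdx (p := p) hf hp

@[fun_prop]
theorem primrec_any {f : α → List β} {p : α → β → Bool} (hf : Primrec f)
    (hp : Primrec fun q : α × β => p q.1 q.2) : Primrec fun x => (f x).any (p x) := by
  have hp' : Primrec fun q : α × β × Bool => p q.1 q.2.1 :=
    hp.comp (Primrec.fst.pair (Primrec.fst.comp Primrec.snd))
  have : Primrec fun x => (f x).foldr (fun a b => p x a || b) false := by fun_prop
  refine this.of_eq fun x => ?_
  induction f x with
  | nil => rfl
  | cons a l ih => simp [ih]

@[fun_prop]
theorem primrec_all {f : α → List β} {p : α → β → Bool} (hf : Primrec f)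
    (hp : Primrec fun q : α × β => p q.1 q.2) : Primrec fun x => (f x).all (p x) := by
  have : Primrec fun x => !(f x).any (fun a => !p x a) := by fun_prop
  refine this.of_eq fun x => ?_
  rw [List.not_any_eq_all_not]
  simp

@[fun_prop]
theorem primrec_filter {f : α → List β} {p : α → β → Bool} (hf : Primrec f)
    (hp : Primrec fun q : α × β => p q.1 q.2) : Primrec fun x => (f x).filter (p x) := by
  have : Primrec fun x => (f x).flatMap fun a => bif p x a then [a] else [] := by fun_prop
  refine this.of_eq fun x => ?_
  induction f x with
  | nil => rfl
  | cons a l ih => cases h : p x a <;> simp [h, ih]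

end SmallOverlap

end PrimrecRules

namespace SmallOverlap

/-! ### Algorithms for presentations over the natural numbers -/

section Algorithms

/-- All sides of the relations. -/
def relWords (L : List (List ℕ × List ℕ)) : List (List ℕ) := L.map Prod.fst ++ L.map Prod.snd

/-- Decides whether `p` is a prefix of `u`. -/
def isPre (p u : List ℕ) : Bool := decide (u.take p.length = p)

/-- Decides whether `p` occurs in `w₁` and in `w₂`, in two different places if these are equal. -/
def commonFactorB (p w₁ w₂ : List ℕ) : Bool :=
  (List.range (w₁.length + 1)).any fun i => (List.range (w₂.length + 1)).any fun j =>
    isPre p (w₁.drop i) && isPre p (w₂.drop j) && (!decide (w₁ = w₂) || !decide (i = j))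

/-- Decides whether `p` is a piece. -/
def pieceB (L : List (List ℕ × List ℕ)) (p : List ℕ) : Bool :=
  decide (p = []) || (relWords L).any fun w₁ => (relWords L).any fun w₂ => commonFactorB p w₁ w₂

/-- All factorisations of a word into three factors. -/
def splits (w : List ℕ) : List (Triple ℕ) :=
  (List.range (w.length + 1)).flatMap fun i => (List.range (w.length + 1)).map fun j =>
    (w.take i, (w.drop i).take j, (w.drop i).drop j)

/-- Decides `IsFact` for a triple whose word is known to be a relation word. -/
def factB (L : List (List ℕ × List ℕ)) (r : Triple ℕ) : Bool :=
  pieceB L r.1 && pieceB L r.2.2 && !pieceB L r.2.1 &&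
    ((List.range (r.word.length + 1)).all fun i =>
      decide (i ≤ r.1.length) || !pieceB L (r.word.take i)) &&
    (List.range (r.word.length + 1)).all fun i =>
      decide (r.word.length - i ≤ r.2.2.length) || !pieceB L (r.word.drop i)

/-- The list of all `r` with `IsFact r`. -/
def table (L : List (List ℕ × List ℕ)) : List (Triple ℕ) :=
  ((relWords L).flatMap splits).filter (factB L)

/-- All sublists of a list. -/
def subLists (l : List (List ℕ)) : List (List (List ℕ)) :=
  l.foldr (fun a acc => acc ++ acc.map fun S => a :: S) [[]]

/-- Decides membership in a list of words. -/
def memB (x : List ℕ) (S : List (List ℕ)) : Bool := S.any fun y => decide (x = y)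

/-- Decides whether the relations connect two relation words: every set of relation words that is
closed under the relations and contains the one must contain the other. -/
def compB (L : List (List ℕ × List ℕ)) (x y : List ℕ) : Bool :=
  (subLists (relWords L)).all fun S =>
    !memB x S || !(L.all fun q => decide (memB q.1 S = memB q.2 S)) || memB y S

/-- Decides, for a prefix `h = XY` of `U`, that no other such prefix starts inside it. -/
def cleanB (tab : List (Triple ℕ)) (h U : List ℕ) : Bool :=
  (List.range h.length).all fun k =>
    decide (k = 0) || tab.all fun t => !isPre t.head (U.drop k)

/-- The clean head of `U`, if there is one. -/
def headOf (tab : List (Triple ℕ)) (U : List ℕ) : Option (Triple ℕ) :=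
  (tab.filter fun r => isPre r.head U && cleanB tab r.head U).head?

/-- Decides whether some suffix of `z` together with `x` begins with a word `XY`. -/
def activeB (tab : List (Triple ℕ)) (z x : List ℕ) : Bool :=
  (List.range (z.length + 1)).any fun m => tab.any fun t => isPre t.head ((z ++ x).drop m)

/-- The position in `x` at which the longest common suffix of `x` and `y` starts. -/
def commonSuffixIdx (x y : List ℕ) : ℕ :=
  (List.range (x.length + 1)).findIdx fun i =>
    decide (y.drop (y.length - (x.length - i)) = x.drop i)

/-- An instruction to change words `U`, `V` and a promise: the words to be put before `U` and
before `V` after deleting prefixes of given lengths, and the new promise. -/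
abbrev Edit := (List ℕ × ℕ) × (List ℕ × ℕ) × List ℕ

/-- The last factor `Z` of some complement of `r` such that `zx` begins with a word `XY` for some
suffix `z` of `Z`, or the empty word if there is none. -/
def activeSuffix (L : List (List ℕ × List ℕ)) (r : Triple ℕ) (x : List ℕ) : List ℕ :=
  (((table L).filter fun k =>
    compB L r.word k.word && activeB (table L) k.2.2 x).head?).elim [] fun k => k.2.2

/-- The reduction of the comparison of `U = XYu` and `V = X'Y'v` when the heads have to be rewritten,
and not both `u` begins with `Z` and `v` with `Z'`. If `u = Zx`, then `Z'x` is compared with `v`, and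
symmetrically. If neither word begins with its last factor, what precedes the longest common suffix
of `Z` and `Z'` is deleted, and this suffix becomes the promise. -/
def joinStep (r s : Triple ℕ) (U V : List ℕ) : Option Edit :=
  bif isPre r.word U then some ((s.2.2, r.word.length), ([], s.head.length), [])
  else bif isPre s.word V then some (([], r.head.length), (r.2.2, s.word.length), [])
  else
    bif isPre (r.head ++ r.2.2.take (commonSuffixIdx r.2.2 s.2.2)) U &&
        isPre (s.head ++ s.2.2.take (commonSuffixIdx s.2.2 r.2.2)) V then
      some (([], r.head.length + commonSuffixIdx r.2.2 s.2.2),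
        ([], s.head.length + commonSuffixIdx s.2.2 r.2.2),
        r.2.2.drop (commonSuffixIdx r.2.2 s.2.2))
    else none

/-- The reduction of the comparison of `U = XYu` and `V = X'Y'v` with promise `p`, the heads being
clean. -/
def headStep (L : List (List ℕ × List ℕ)) (r s : Triple ℕ) (U V p : List ℕ) : Option Edit :=
  bif compB L r.word s.word &&
      (table L).any fun k => compB L r.word k.word && isPre p k.1 then
    bif isPre r.word U && isPre s.word V then
      some ((activeSuffix L r (U.drop r.word.length), r.word.length),
        (activeSuffix L r (U.drop r.word.length), s.word.length), [])
    else bif decide (r = s) && isPre p r.1 then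
      some (([], r.head.length), ([], s.head.length), [])
    else joinStep r s U V
  else none

/-- The reduction that compares and deletes first letters. -/
def letterStep (U V p : List ℕ) : Option Edit :=
  bif !decide (U = []) && decide (U.head? = V.head?) &&
      (decide (p = []) || decide (p.head? = U.head?)) then
    some (([], 1), ([], 1), p.tail)
  else none

/-- The reduction of the comparison of `U` and `V` with promise `p`. -/
def plan (L : List (List ℕ × List ℕ)) (U V p : List ℕ) : Option Edit :=
  (headOf (table L) U).elim (letterStep U V p) fun r =>
    (headOf (table L) V).elim (letterStep U V p) fun s => headStep L r s U V p

/-- A bound for the lengths of the relation words. -/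
def maxLen (L : List (List ℕ × List ℕ)) : ℕ := (relWords L).flatten.length

/-- The number of letters of each word that have to be known for a reduction: finding out whether a
head is clean requires the inspection of another head that starts inside of it. -/
def lookahead (L : List (List ℕ × List ℕ)) : ℕ := 2 * maxLen L + 1

/-- A state: the known but unprocessed parts of the two words, and the promise. -/
abbrev State := List ℕ × List ℕ × List ℕ

/-- Performs a reduction. -/
def reduce (L : List (List ℕ × List ℕ)) (st : State) : Option State :=
  (plan L (st.1.take (lookahead L)) (st.2.1.take (lookahead L)) st.2.2).bind fun e =>
    some (e.1.1 ++ st.1.drop e.1.2, e.2.1.1 ++ st.2.1.drop e.2.1.2, e.2.2)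

/-- Decides whether more of a word has to be read, the known part being `s` and the end-marker `n`. -/
def short (L : List (List ℕ × List ℕ)) (n : ℕ) (s : List ℕ) : Bool :=
  decide (s.length < lookahead L) && s.all fun a => !decide (a = n)

/-- Performs a reduction, unless more has to be read. -/
def tryReduce (L : List (List ℕ × List ℕ)) (n : ℕ) (o : Option State) : Option State :=
  o.bind fun st => bif short L n st.1 || short L n st.2.1 then some st else reduce L st

/-- A bound for the number of reductions that can follow the reading of a letter. -/
def reductionBound (L : List (List ℕ × List ℕ)) : ℕ := (maxLen L + 1) * (lookahead L + 1)

/-- The result of reading the letter `a`. -/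
def next (L : List (List ℕ × List ℕ)) (n : ℕ) (st : State) (a : ℕ) : Option State :=
  (tryReduce L n)^[reductionBound L]
    (bif short L n st.1 then some (st.1 ++ [a], st.2)
      else bif short L n st.2.1 then some (st.1, st.2.1 ++ [a], st.2.2) else none)

/-- All words of length at most `m` in the letters `0, …, n`. -/
def wordsUpTo (n m : ℕ) : List (List ℕ) :=
  (fun W => [] :: W.flatMap fun w => (List.range (n + 1)).map fun a => a :: w)^[m] [[]]

/-- A finite list of states that contains all states that are reached. -/
def allStates (L : List (List ℕ × List ℕ)) (n : ℕ) : List State :=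
  (wordsUpTo n (maxLen L + lookahead L)).flatMap fun s =>
    (wordsUpTo n (maxLen L + lookahead L)).flatMap fun t =>
      (wordsUpTo n (maxLen L + lookahead L)).map fun p => (s, t, p)

/-- The input symbols of the automaton. -/
def symbols (n : ℕ) : List (Option ℕ) := none :: (List.range n).map some

/-- The automaton for the equivalence of words over `{0, …, n - 1}`. -/
def automaton (n : ℕ) (L : List (List ℕ × List ℕ)) : AutomatonCode :=
  ((allStates L n).map Encodable.encode,
    ((allStates L n).filter fun st => short L n st.1).map Encodable.encode,
    Encodable.encode (([], [], []) : State),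
    [Encodable.encode (([], [], []) : State)],
    (allStates L n).flatMap fun st => (symbols n).flatMap fun a =>
      (((next L n st (a.elim n id)).toList).filter fun st' =>
        (allStates L n).any fun x => decide (st' = x)).map fun st' =>
          (Encodable.encode st, a, Encodable.encode st'))

end Algorithms

/-! ### The algorithms are primitive recursive -/

section Primrec

variable {α : Type*} [Primcodable α]

@[fun_prop]
theorem primrec_head {f : α → Triple ℕ} (hf : Primrec f) : Primrec fun x => (f x).head := by
  unfold Triple.head; fun_prop

@[fun_prop]
theorem primrec_word {f : α → Triple ℕ} (hf : Primrec f) : Primrec fun x => (f x).word := by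
  unfold Triple.word; fun_prop

@[fun_prop]
theorem primrec_relWords {f : α → List (List ℕ × List ℕ)} (hf : Primrec f) :
    Primrec fun x => relWords (f x) := by
  unfold relWords; fun_prop

@[fun_prop]
theorem primrec_isPre {f g : α → List ℕ} (hf : Primrec f) (hg : Primrec g) :
    Primrec fun x => isPre (f x) (g x) := by
  unfold isPre; fun_prop

@[fun_prop]
theorem primrec_commonFactorB {f g h : α → List ℕ} (hf : Primrec f) (hg : Primrec g)
    (hh : Primrec h) : Primrec fun x => commonFactorB (f x) (g x) (h x) := by
  unfold commonFactorB; fun_prop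

@[fun_prop]
theorem primrec_pieceB {f : α → List (List ℕ × List ℕ)} {g : α → List ℕ} (hf : Primrec f)
    (hg : Primrec g) : Primrec fun x => pieceB (f x) (g x) := by
  unfold pieceB; fun_prop

@[fun_prop]
theorem primrec_splits {f : α → List ℕ} (hf : Primrec f) : Primrec fun x => splits (f x) := by
  unfold splits; fun_prop

@[fun_prop]
theorem primrec_factB {f : α → List (List ℕ × List ℕ)} {g : α → Triple ℕ} (hf : Primrec f)
    (hg : Primrec g) : Primrec fun x => factB (f x) (g x) := by
  unfold factB; fun_prop

@[fun_prop]
theorem primrec_table {f : α → List (List ℕ × List ℕ)} (hf : Primrec f) :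
    Primrec fun x => table (f x) := by
  unfold table; fun_prop

@[fun_prop]
theorem primrec_subLists {f : α → List (List ℕ)} (hf : Primrec f) :
    Primrec fun x => subLists (f x) := by
  unfold subLists; fun_prop

@[fun_prop]
theorem primrec_memB {f : α → List ℕ} {g : α → List (List ℕ)} (hf : Primrec f)
    (hg : Primrec g) : Primrec fun x => memB (f x) (g x) := by
  unfold memB; fun_prop

@[fun_prop]
theorem primrec_compB {f : α → List (List ℕ × List ℕ)} {g h : α → List ℕ} (hf : Primrec f)
    (hg : Primrec g) (hh : Primrec h) : Primrec fun x => compB (f x) (g x) (h x) := by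
  unfold compB; fun_prop

@[fun_prop]
theorem primrec_cleanB {f : α → List (Triple ℕ)} {g h : α → List ℕ} (hf : Primrec f)
    (hg : Primrec g) (hh : Primrec h) : Primrec fun x => cleanB (f x) (g x) (h x) := by
  unfold cleanB; fun_prop

@[fun_prop]
theorem primrec_headOf {f : α → List (Triple ℕ)} {g : α → List ℕ} (hf : Primrec f)
    (hg : Primrec g) : Primrec fun x => headOf (f x) (g x) := by
  unfold headOf; fun_prop

@[fun_prop]
theorem primrec_activeB {f : α → List (Triple ℕ)} {g h : α → List ℕ} (hf : Primrec f)
    (hg : Primrec g) (hh : Primrec h) : Primrec fun x => activeB (f x) (g x) (h x) := by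
  unfold activeB; fun_prop

@[fun_prop]
theorem primrec_commonSuffixIdx {f g : α → List ℕ} (hf : Primrec f) (hg : Primrec g) :
    Primrec fun x => commonSuffixIdx (f x) (g x) := by
  unfold commonSuffixIdx; fun_prop

@[fun_prop]
theorem primrec_activeSuffix {f : α → List (List ℕ × List ℕ)} {r : α → Triple ℕ}
    {g : α → List ℕ} (hf : Primrec f) (hr : Primrec r) (hg : Primrec g) :
    Primrec fun x => activeSuffix (f x) (r x) (g x) := by
  unfold activeSuffix; fun_prop

@[fun_prop]
theorem primrec_joinStep {r s : α → Triple ℕ} {g h : α → List ℕ} (hr : Primrec r)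
    (hs : Primrec s) (hg : Primrec g) (hh : Primrec h) :
    Primrec fun x => joinStep (r x) (s x) (g x) (h x) := by
  unfold joinStep; fun_prop

@[fun_prop]
theorem primrec_headStep {f : α → List (List ℕ × List ℕ)} {r s : α → Triple ℕ}
    {g h k : α → List ℕ} (hf : Primrec f) (hr : Primrec r) (hs : Primrec s) (hg : Primrec g)
    (hh : Primrec h) (hk : Primrec k) :
    Primrec fun x => headStep (f x) (r x) (s x) (g x) (h x) (k x) := by
  unfold headStep; fun_prop

@[fun_prop]
theorem primrec_letterStep {g h k : α → List ℕ} (hg : Primrec g) (hh : Primrec h)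
    (hk : Primrec k) : Primrec fun x => letterStep (g x) (h x) (k x) := by
  unfold letterStep; fun_prop

@[fun_prop]
theorem primrec_plan {f : α → List (List ℕ × List ℕ)} {g h k : α → List ℕ} (hf : Primrec f)
    (hg : Primrec g) (hh : Primrec h) (hk : Primrec k) :
    Primrec fun x => plan (f x) (g x) (h x) (k x) := by
  unfold plan; fun_prop

@[fun_prop]
theorem primrec_maxLen {f : α → List (List ℕ × List ℕ)} (hf : Primrec f) :
    Primrec fun x => maxLen (f x) := by
  unfold maxLen; fun_prop

@[fun_prop]
theorem primrec_lookahead {f : α → List (List ℕ × List ℕ)} (hf : Primrec f) :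
    Primrec fun x => lookahead (f x) := by
  unfold lookahead; fun_prop

@[fun_prop]
theorem primrec_reduce {f : α → List (List ℕ × List ℕ)} {st : α → State} (hf : Primrec f)
    (hst : Primrec st) : Primrec fun x => reduce (f x) (st x) := by
  unfold reduce; fun_prop

@[fun_prop]
theorem primrec_short {f : α → List (List ℕ × List ℕ)} {n : α → ℕ} {s : α → List ℕ}
    (hf : Primrec f) (hn : Primrec n) (hs : Primrec s) :
    Primrec fun x => short (f x) (n x) (s x) := by
  unfold short; fun_prop

@[fun_prop]
theorem primrec_tryReduce {f : α → List (List ℕ × List ℕ)} {n : α → ℕ} {o : α → Option State}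
    (hf : Primrec f) (hn : Primrec n) (ho : Primrec o) :
    Primrec fun x => tryReduce (f x) (n x) (o x) := by
  unfold tryReduce; fun_prop

@[fun_prop]
theorem primrec_next {f : α → List (List ℕ × List ℕ)} {n a : α → ℕ} {st : α → State}
    (hf : Primrec f) (hn : Primrec n) (hst : Primrec st) (ha : Primrec a) :
    Primrec fun x => next (f x) (n x) (st x) (a x) := by
  unfold next reductionBound; fun_prop

@[fun_prop]
theorem primrec_wordsUpTo {n m : α → ℕ} (hn : Primrec n) (hm : Primrec m) :
    Primrec fun x => wordsUpTo (n x) (m x) := by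
  unfold wordsUpTo; fun_prop

@[fun_prop]
theorem primrec_allStates {f : α → List (List ℕ × List ℕ)} {n : α → ℕ} (hf : Primrec f)
    (hn : Primrec n) : Primrec fun x => allStates (f x) (n x) := by
  unfold allStates; fun_prop

@[fun_prop]
theorem primrec_symbols {n : α → ℕ} (hn : Primrec n) : Primrec fun x => symbols (n x) := by
  unfold symbols; fun_prop

@[fun_prop]
theorem primrec_automaton {f : α → List (List ℕ × List ℕ)} {n : α → ℕ} (hn : Primrec n)
    (hf : Primrec f) : Primrec fun x => automaton (n x) (f x) := by
  unfold automaton; fun_prop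

end Primrec

/-! ### Correctness of the algorithms -/

section Correctness

variable {L : List (List ℕ × List ℕ)} {r s : Triple ℕ} {U V p x y u v : List ℕ}

theorem mem_relWords {w : List ℕ} : w ∈ relWords L ↔ IsRelationWord {r | r ∈ L} w := by
  simp [relWords, IsRelationWord, exists_or]

theorem isPre_iff : isPre p u = true ↔ p <+: u := by
  rw [isPre, decide_eq_true_iff, List.prefix_iff_eq_take, eq_comm]

theorem pieceB_iff : pieceB L p = true ↔ IsPiece {r | r ∈ L} p := by
  simp only [pieceB, commonFactorB, Bool.or_eq_true, decide_eq_true_iff, List.any_eq_true,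
    List.mem_range, Bool.and_eq_true, isPre_iff, Bool.not_eq_true', decide_eq_false_iff_not,
    IsPiece, mem_relWords]
  refine or_congr_right ⟨?_, ?_⟩
  · rintro ⟨w₁, h₁, w₂, h₂, i, hi, j, hj, ⟨⟨t₁, e₁⟩, t₂, e₂⟩, hne⟩
    refine ⟨w₁, w₂, w₁.take i, t₁, w₂.take j, t₂, h₁, h₂, ?_, ?_, hne.imp_right fun h h' => h ?_⟩
    · rw [List.append_assoc, e₁, List.take_append_drop]
    · rw [List.append_assoc, e₂, List.take_append_drop]
    · have := congrArg List.length h'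
      simp only [List.length_take] at this
      omega
  · rintro ⟨w₁, w₂, s₁, t₁, s₂, t₂, h₁, h₂, e₁, e₂, hne⟩
    refine ⟨w₁, h₁, w₂, h₂, s₁.length, ?_, s₂.length, ?_, ⟨⟨t₁, ?_⟩, t₂, ?_⟩, ?_⟩
    · simp [e₁]
    · simp [e₂]
    · simp [e₁]
    · simp [e₂]
    · by_contra h
      push Not at h
      obtain ⟨rfl, h⟩ := h
      refine hne.elim (fun h => h rfl) fun hne => hne ?_
      rw [e₁, List.append_assoc, List.append_assoc] at e₂
      exact (List.append_inj e₂ h).1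

theorem mem_splits {w : List ℕ} : r ∈ splits w ↔ r.word = w := by
  simp only [splits, List.mem_flatMap, List.mem_map, List.mem_range]
  constructor
  · rintro ⟨i, -, j, -, rfl⟩
    simp only [Triple.word, Triple.X, Triple.Y, Triple.Z, List.append_assoc,
      List.take_append_drop]
  · obtain ⟨X, Y, Z⟩ := r
    rintro rfl
    refine ⟨X.length, ?_, Y.length, ?_, ?_⟩
    · simp [Triple.word]
    · simp [Triple.word, Triple.X, Triple.Y, Triple.Z]; omega
    · simp [Triple.word]

theorem factB_iff (hr : IsRelationWord {r | r ∈ L} r.word) :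
    factB L r = true ↔ IsFact {r | r ∈ L} r := by
  simp only [factB, Bool.and_eq_true, List.all_eq_true, List.mem_range, Bool.or_eq_true,
    decide_eq_true_iff, Bool.not_eq_true', ← Bool.not_eq_true, pieceB_iff]
  constructor
  · rintro ⟨⟨⟨⟨h₁, h₂⟩, h₃⟩, h₄⟩, h₅⟩
    refine ⟨hr, h₁, h₂, h₃, fun p t e hp => ?_, fun s p e hp => ?_⟩
    · refine (h₄ p.length (by simp [e])).resolve_right ?_
      simpa [e] using hp
    · have := (h₅ s.length (by simp [e])).resolve_right (by simpa [e] using hp)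
      rw [e] at this
      simpa using this
  · intro h
    refine ⟨⟨⟨⟨h.pieceX, h.pieceZ⟩, h.middle⟩, fun i hi => ?_⟩, fun i hi => ?_⟩
    · rw [or_iff_not_imp_right, not_not]
      intro hp
      have := h.maxX _ _ (List.take_append_drop i _).symm hp
      rw [List.length_take] at this
      have hX : i ≤ r.X.length := by omega
      exact hX
    · rw [or_iff_not_imp_right, not_not]
      intro hp
      have := h.maxZ _ _ (List.take_append_drop i _).symm hp
      rwa [List.length_drop] at this

theorem mem_table : r ∈ table L ↔ IsFact {r | r ∈ L} r := by
  simp only [table, List.mem_filter, List.mem_flatMap, mem_splits, mem_relWords]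
  constructor
  · rintro ⟨⟨_, h, rfl⟩, h'⟩
    exact (factB_iff h).1 h'
  · exact fun h => ⟨⟨_, h.word, rfl⟩, (factB_iff h.word).2 h⟩

theorem filter_mem_subLists (q : List ℕ → Bool) (l : List (List ℕ)) :
    l.filter q ∈ subLists l := by
  induction l with
  | nil => simp [subLists]
  | cons a l ih =>
    have e : subLists (a :: l) = subLists l ++ (subLists l).map fun S => a :: S := rfl
    rw [e, List.mem_append]
    cases h : q a
    · left; simpa [h] using ih
    · right; simpa [h] using ih

theorem memB_iff {S : List (List ℕ)} : memB x S = true ↔ x ∈ S := by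
  simp [memB]

theorem compB_iff (hx : x ∈ relWords L) (hy : y ∈ relWords L) :
    compB L x y = true ↔ Relation.EqvGen (fun x y => (x, y) ∈ {r | r ∈ L}) x y := by
  classical
  have hS : ∀ S (q : List ℕ × List ℕ), memB q.1 S = memB q.2 S ↔ (q.1 ∈ S ↔ q.2 ∈ S) :=
    fun S q => by rw [Bool.eq_iff_iff, memB_iff, memB_iff]
  simp only [compB, List.all_eq_true, Bool.or_eq_true, Bool.not_eq_true', ← Bool.not_eq_true,
    memB_iff, decide_eq_true_iff, hS]
  constructor
  · intro h
    have key := h _ (filter_mem_subLists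
      (fun w => decide (Relation.EqvGen (fun x y => (x, y) ∈ {r | r ∈ L}) x w)) (relWords L))
    simp only [List.mem_filter, decide_eq_true_iff, hx, hy, true_and] at key
    rcases key with (h | h) | h
    · exact absurd (.refl x) h
    · refine absurd (fun q hq => ?_) h
      have hq' : Relation.EqvGen (fun x y => (x, y) ∈ {r | r ∈ L}) q.1 q.2 := .rel _ _ hq
      have h₁ : q.1 ∈ relWords L := mem_relWords.2 ⟨q.2, Or.inl hq⟩
      have h₂ : q.2 ∈ relWords L := mem_relWords.2 ⟨q.1, Or.inr hq⟩
      simp only [h₁, h₂, true_and]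
      exact ⟨fun h => h.trans _ _ _ hq', fun h => h.trans _ _ _ (.symm _ _ hq')⟩
    · exact h
  · intro h S hS
    by_cases hcl : ∀ q ∈ L, q.1 ∈ S ↔ q.2 ∈ S
    · have : x ∈ S ↔ y ∈ S := by
        clear hx hy
        induction h with
        | rel x y h => exact hcl _ h
        | refl => rfl
        | symm _ _ _ ih => exact ih.symm
        | trans _ _ _ _ _ ih₁ ih₂ => exact ih₁.trans ih₂
      tauto
    · tauto

theorem IsFact.compB_iff (hr : IsFact {r | r ∈ L} r) (hs : IsFact {r | r ∈ L} s) :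
    compB L r.word s.word = true ↔ Comp {r | r ∈ L} r s := by
  rw [SmallOverlap.compB_iff (mem_relWords.2 hr.word) (mem_relWords.2 hs.word)]
  exact ⟨fun h => ⟨hr, hs, h⟩, fun h => h.2.2⟩

theorem condHead_iff (hr : IsFact {r | r ∈ L} r) :
    (isPre r.head U && cleanB (table L) r.head U) = true ↔
      CleanHead {r | r ∈ L} r U (U.drop r.head.length) := by
  simp only [Bool.and_eq_true, cleanB, List.all_eq_true, List.mem_range, Bool.or_eq_true,
    decide_eq_true_iff, Bool.not_eq_true', ← Bool.not_eq_true, isPre_iff, mem_table]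
  constructor
  · rintro ⟨⟨u, rfl⟩, h⟩
    refine ⟨hr, by simp, fun s c y q hs hc hy e e' => ?_⟩
    have hlt : c.length < r.head.length := by
      have := List.length_pos_iff.2 hy
      rw [e, List.length_append]; omega
    refine ((h c.length hlt).resolve_left fun h => hc (List.length_eq_zero_iff.1 h)) s hs ⟨q, ?_⟩
    rw [← e']
    simp [e]
  · rintro ⟨-, e, h⟩
    refine ⟨⟨_, e.symm⟩, fun k hk => or_iff_not_imp_left.2 fun hk0 t ht hpre => ?_⟩
    obtain ⟨q, hq⟩ := hpre
    refine h t (r.head.take k) (r.head.drop k) q ht ?_ ?_ (List.take_append_drop _ _).symm ?_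
    · simp only [ne_eq, List.take_eq_nil_iff, not_or]
      exact ⟨hk0, fun h => by simp [h] at hk⟩
    · simp only [ne_eq, List.drop_eq_nil_iff]; omega
    · rw [hq]
      conv_rhs => rw [e]
      rw [List.drop_append_of_le_length hk.le]

theorem headOf_eq_some (h : headOf (table L) U = some r) :
    CleanHead {r | r ∈ L} r U (U.drop r.head.length) := by
  obtain ⟨h₁, h₂⟩ := List.mem_filter.1 (List.mem_of_head? h)
  exact (condHead_iff (mem_table.1 h₁)).1 h₂

theorem headOf_eq_none (h : headOf (table L) U = none) :
    ¬ ∃ r u, CleanHead {r | r ∈ L} r U u := by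
  rintro ⟨r, u, hu⟩
  rw [headOf, List.head?_eq_none_iff, List.filter_eq_nil_iff] at h
  refine h r (mem_table.2 hu.fact) ((condHead_iff hu.fact).2 ?_)
  have : U.drop r.head.length = u := by simp [hu.eq]
  rwa [this]

theorem commonSuffixIdx_lt : commonSuffixIdx x y < x.length + 1 := by
  have h := List.findIdx_lt_length_of_exists (xs := List.range (x.length + 1))
    (p := fun i => decide (y.drop (y.length - (x.length - i)) = x.drop i))
    ⟨x.length, by simp, by simp⟩
  simpa [commonSuffixIdx] using h

theorem drop_commonSuffixIdx_suffix : x.drop (commonSuffixIdx x y) <:+ y := by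
  have h := List.findIdx_getElem (xs := List.range (x.length + 1))
    (p := fun i => decide (y.drop (y.length - (x.length - i)) = x.drop i))
    (w := by simpa [commonSuffixIdx] using commonSuffixIdx_lt (x := x) (y := y))
  simp only [List.getElem_range, decide_eq_true_iff] at h
  rw [commonSuffixIdx, ← h]
  exact List.drop_suffix _ _

theorem suffix_drop_commonSuffixIdx (hx : p <:+ x) (hy : p <:+ y) :
    p <:+ x.drop (commonSuffixIdx x y) := by
  refine List.suffix_of_suffix_length_le hx (List.drop_suffix _ _) ?_
  have hle := hx.length_le
  rw [List.length_drop]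
  suffices commonSuffixIdx x y ≤ x.length - p.length by omega
  by_contra h
  have h' := List.not_of_lt_findIdx (xs := List.range (x.length + 1))
    (p := fun i => decide (y.drop (y.length - (x.length - i)) = x.drop i)) (Nat.lt_of_not_le h)
  simp only [List.getElem_range, decide_eq_false_iff_not, Nat.sub_sub_self hle] at h'
  apply h'
  rw [← List.suffix_iff_eq_drop.1 hx, ← List.suffix_iff_eq_drop.1 hy]

theorem drop_commonSuffixIdx_comm :
    x.drop (commonSuffixIdx x y) = y.drop (commonSuffixIdx y x) := by
  have h₁ : x.drop (commonSuffixIdx x y) <:+ y.drop (commonSuffixIdx y x) :=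
    suffix_drop_commonSuffixIdx drop_commonSuffixIdx_suffix (List.drop_suffix _ _)
  have h₂ : y.drop (commonSuffixIdx y x) <:+ x.drop (commonSuffixIdx x y) :=
    suffix_drop_commonSuffixIdx drop_commonSuffixIdx_suffix (List.drop_suffix _ _)
  exact h₁.eq_of_length_le h₂.length_le

/-! ### Reductions look only a bounded distance ahead -/

theorem isPre_take {K : ℕ} (h : p.length ≤ K) : isPre p (U.take K) = isPre p U := by
  rw [isPre, isPre, List.take_take, min_eq_left h]

theorem isPre_drop_take {K k : ℕ} (h : k + p.length ≤ K) :
    isPre p ((U.take K).drop k) = isPre p (U.drop k) := by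
  rw [List.drop_take, isPre_take (by omega)]

theorem IsFact.length_word_le (hr : IsFact {r | r ∈ L} r) : r.word.length ≤ maxLen L := by
  have h := List.le_sum_of_mem (List.mem_map_of_mem (f := List.length) (mem_relWords.2 hr.word))
  rwa [← List.length_flatten] at h

theorem length_word : r.word.length = r.head.length + r.2.2.length := by
  rw [Triple.word_eq, List.length_append]

theorem headOf_take : headOf (table L) (U.take (lookahead L)) = headOf (table L) U := by
  unfold headOf
  congr 1
  refine List.filter_congr fun r hr => ?_
  have hr' := (mem_table.1 hr).length_word_le
  rw [length_word] at hr'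
  have hl : lookahead L = 2 * maxLen L + 1 := rfl
  rw [isPre_take (by omega)]
  congr 1
  unfold cleanB
  rw [Bool.eq_iff_iff]
  simp only [List.all_eq_true, List.mem_range, Bool.or_eq_true, decide_eq_true_iff]
  refine forall₂_congr fun k hk => or_congr_right (forall₂_congr fun t ht => ?_)
  have ht' := (mem_table.1 ht).length_word_le
  rw [length_word] at ht'
  rw [isPre_drop_take (by omega)]

theorem activeB_take {K : ℕ} {z : List ℕ} (hK : maxLen L ≤ K) :
    activeB (table L) z (x.take K) = activeB (table L) z x := by
  unfold activeB
  rw [Bool.eq_iff_iff]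
  simp only [List.any_eq_true, List.mem_range]
  refine exists_congr fun m => and_congr_right fun hm => exists_congr fun t =>
    and_congr_right fun ht => ?_
  have ht' := (mem_table.1 ht).length_word_le
  rw [length_word] at ht'
  rw [List.drop_append_of_le_length (by omega), List.drop_append_of_le_length (by omega),
    ← isPre_take (U := z.drop m ++ x) (K := (z.drop m).length + K) (by omega),
    List.take_length_add_append]

theorem activeSuffix_take {K : ℕ} (hK : maxLen L ≤ K) :
    activeSuffix L r (x.take K) = activeSuffix L r x := by
  simp only [activeSuffix, activeB_take hK]

theorem headStep_take (hr : IsFact {r | r ∈ L} r) (hs : IsFact {r | r ∈ L} s) :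
    headStep L r s (U.take (lookahead L)) (V.take (lookahead L)) p = headStep L r s U V p := by
  have hl : lookahead L = 2 * maxLen L + 1 := rfl
  have h₁ := hr.length_word_le
  have h₂ := hs.length_word_le
  have h₃ := @commonSuffixIdx_lt r.2.2 s.2.2
  have h₄ := @commonSuffixIdx_lt s.2.2 r.2.2
  have h₁' := h₁
  have h₂' := h₂
  rw [length_word] at h₁' h₂'
  unfold headStep joinStep
  rw [List.drop_take, activeSuffix_take (by omega), isPre_take (by omega), isPre_take (by omega),
    isPre_take (by rw [List.length_append, List.length_take]; omega),
    isPre_take (by rw [List.length_append, List.length_take]; omega)]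

theorem letterStep_take :
    letterStep (U.take (lookahead L)) (V.take (lookahead L)) p = letterStep U V p := by
  cases U <;> cases V <;> rfl

theorem plan_take :
    plan L (U.take (lookahead L)) (V.take (lookahead L)) p = plan L U V p := by
  unfold plan
  rw [headOf_take, headOf_take, letterStep_take]
  cases hU : headOf (table L) U with
  | none => rfl
  | some r =>
    cases hV : headOf (table L) V with
    | none => rfl
    | some s => exact headStep_take (headOf_eq_some hU).fact (headOf_eq_some hV).fact

end Correctness

section Correctness

variable {L : List (List ℕ × List ℕ)} {r s : Triple ℕ} {U V p x y u v : List ℕ}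

/-! ### Correctness of the reductions -/

theorem activeSuffix_cases (hr : IsFact {r | r ∈ L} r) :
    (∃ k m t q, Comp {r | r ∈ L} r k ∧ activeSuffix L r x = k.2.2 ∧ IsFact {r | r ∈ L} t ∧
      k.2.2.drop m ++ x = t.head ++ q) ∨
    (activeSuffix L r x = [] ∧ ∀ k a z t q, Comp {r | r ∈ L} r k → k.Z = a ++ z →
      IsFact {r | r ∈ L} t → z ++ x ≠ t.head ++ q) := by
  unfold activeSuffix
  cases h : ((table L).filter fun k =>
    compB L r.word k.word && activeB (table L) k.2.2 x).head? with
  | some k =>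
    obtain ⟨h₁, h₂⟩ := List.mem_filter.1 (List.mem_of_head? h)
    rw [mem_table] at h₁
    simp only [Bool.and_eq_true, hr.compB_iff h₁, activeB, List.any_eq_true, List.mem_range,
      mem_table, isPre_iff] at h₂
    obtain ⟨hk, m, hm, t, ht, q, hq⟩ := h₂
    rw [List.drop_append_of_le_length (by omega)] at hq
    exact Or.inl ⟨k, m, t, q, hk, rfl, ht, hq.symm⟩
  | none =>
    refine Or.inr ⟨rfl, fun k a z t q hk e ht e' => ?_⟩
    rw [List.head?_eq_none_iff, List.filter_eq_nil_iff] at h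
    refine h k (mem_table.2 hk.2.1) ?_
    simp only [Bool.and_eq_true, hr.compB_iff hk.2.1, activeB, List.any_eq_true, List.mem_range,
      mem_table, isPre_iff]
    have e : k.2.2 = a ++ z := e
    exact ⟨hk, a.length, by simp [e], t, ht, q, by simp [e, e']⟩

/-- By uniqueness, it does not matter which complement is chosen. -/
theorem link_iff_activeSuffix (hr : IsFact {r | r ∈ L} r) :
    Link {r | r ∈ L} r x y ↔
      Eqv {r | r ∈ L} (activeSuffix L r x ++ x) (activeSuffix L r x ++ y) := by
  rcases activeSuffix_cases (x := x) hr with ⟨k, m, t, q, hk, e, ht, e'⟩ | ⟨e, h⟩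
  · rw [e]
    exact link_iff_of_active_prefix hk (a := k.2.2.take m) (List.take_append_drop _ _).symm ht e'
  · rw [e]
    exact link_iff_of_no_active_prefix hr h

theorem activeSuffix_piece (hr : IsFact {r | r ∈ L} r) :
    IsPiece {r | r ∈ L} (activeSuffix L r x) := by
  rcases activeSuffix_cases (x := x) hr with ⟨k, m, t, q, hk, e, -⟩ | ⟨e, -⟩
  · rw [e]; exact hk.2.1.pieceZ
  · exact Or.inl e

/-- `e` is a correct instruction, or a correct refusal, for the comparison of `U` and `V`. -/
def Sound (L : List (List ℕ × List ℕ)) (U V : List ℕ) (P : Prop) (e : Option Edit) : Prop :=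
  e.elim (¬ P) fun e => P ↔
    Holds {r | r ∈ L} (e.1.1 ++ U.drop e.1.2) (e.2.1.1 ++ V.drop e.2.1.2) e.2.2

theorem sound_cond {P : Prop} {b : Bool} {e f : Option Edit} (h₁ : b = true → Sound L U V P e)
    (h₂ : ¬ b = true → Sound L U V P f) : Sound L U V P (bif b then e else f) := by
  cases b
  · exact h₂ (by simp)
  · exact h₁ rfl

theorem word_prefix_iff : r.word <+: r.head ++ u ↔ r.Z <+: u :=
  List.prefix_append_right_inj _

theorem joinStep_sound (hc : Comp {r | r ∈ L} r s)
    (hn : ¬ (r.word <+: r.head ++ u ∧ s.word <+: s.head ++ v)) :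
    Sound L (r.head ++ u) (s.head ++ v) (Joined {r | r ∈ L} r s u v)
      (joinStep r s (r.head ++ u) (s.head ++ v)) := by
  rw [word_prefix_iff, word_prefix_iff] at hn
  refine sound_cond (fun h => ?_) fun hu => sound_cond (fun h => ?_) fun hv =>
    sound_cond (fun h => ?_) fun h => ?_
  · rw [isPre_iff, word_prefix_iff] at h
    have hv : ¬ s.Z <+: v := fun h' => hn ⟨h, h'⟩
    obtain ⟨x, rfl⟩ := h
    simp only [Sound, Option.elim_some, Holds.nil_right]
    rw [joined_prefix_left_iff hc hv, ← List.append_assoc, ← Triple.word_eq]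
    simp
  · rw [isPre_iff, word_prefix_iff] at h hu
    obtain ⟨x, rfl⟩ := h
    simp only [Sound, Option.elim_some, Holds.nil_right]
    rw [joined_prefix_right_iff hc hu, ← List.append_assoc, ← Triple.word_eq]
    simp
  all_goals
    rw [isPre_iff, word_prefix_iff] at hu hv
    have key := joined_iff_of_not_prefix (z := r.2.2.drop (commonSuffixIdx r.2.2 s.2.2))
      (a := r.2.2.take (commonSuffixIdx r.2.2 s.2.2))
      (b := s.2.2.take (commonSuffixIdx s.2.2 r.2.2)) hc hu hv
      (List.take_append_drop _ _).symm
      (by rw [drop_commonSuffixIdx_comm]; exact (List.take_append_drop _ _).symm)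
      (fun _ => suffix_drop_commonSuffixIdx)
    rw [Bool.and_eq_true, isPre_iff, isPre_iff, List.prefix_append_right_inj,
      List.prefix_append_right_inj] at h
  · obtain ⟨⟨u', hu'⟩, v', hv'⟩ := h
    have h₁ : (r.2.2.take (commonSuffixIdx r.2.2 s.2.2)).length =
        commonSuffixIdx r.2.2 s.2.2 := by
      have := @commonSuffixIdx_lt r.2.2 s.2.2
      rw [List.length_take]; omega
    have h₂ : (s.2.2.take (commonSuffixIdx s.2.2 r.2.2)).length =
        commonSuffixIdx s.2.2 r.2.2 := by
      have := @commonSuffixIdx_lt s.2.2 r.2.2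
      rw [List.length_take]; omega
    have h₃ : (r.head ++ u).drop (r.head.length + commonSuffixIdx r.2.2 s.2.2) = u' := by
      rw [← hu', ← List.append_assoc, List.drop_left' (by rw [List.length_append, h₁])]
    have h₄ : (s.head ++ v).drop (s.head.length + commonSuffixIdx s.2.2 r.2.2) = v' := by
      rw [← hv', ← List.append_assoc, List.drop_left' (by rw [List.length_append, h₂])]
    simp only [Sound, Option.elim_some, List.nil_append, h₃, h₄]
    rw [key]
    constructor
    · rintro ⟨u₁, v₁, e₁, e₂, h⟩
      obtain rfl := List.append_cancel_left (hu'.trans e₁)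
      obtain rfl := List.append_cancel_left (hv'.trans e₂)
      exact h
    · exact fun h => ⟨u', v', hu'.symm, hv'.symm, h⟩
  · rw [Sound, Option.elim_none, key]
    rintro ⟨u', v', rfl, rfl, -⟩
    exact h ⟨List.prefix_append _ _, List.prefix_append _ _⟩

theorem headStep_sound (hU : CleanHead {r | r ∈ L} r U u) (hV : CleanHead {r | r ∈ L} s V v)
    (hp : IsPiece {r | r ∈ L} p) :
    Sound L U V (Holds {r | r ∈ L} U V p) (headStep L r s U V p) := by
  have hcond : (compB L r.word s.word &&
      (table L).any fun k => compB L r.word k.word && isPre p k.1) = true ↔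
      Comp {r | r ∈ L} r s ∧ ∃ k, Comp {r | r ∈ L} r k ∧ p <+: k.X := by
    rw [Bool.and_eq_true, hU.fact.compB_iff hV.fact, List.any_eq_true]
    refine and_congr_right fun _ => exists_congr fun k => ?_
    rw [Bool.and_eq_true, isPre_iff]
    constructor
    · rintro ⟨hk, h₁, h₂⟩
      exact ⟨(hU.fact.compB_iff (mem_table.1 hk)).1 h₁, h₂⟩
    · rintro ⟨hk, h⟩
      exact ⟨mem_table.2 hk.2.1, (hU.fact.compB_iff hk.2.1).2 hk, h⟩
  refine sound_cond (fun h => ?_) fun h hH => h (hcond.2 (hH.comp hp hU hV))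
  obtain ⟨hc, hk⟩ := hcond.1 h
  obtain rfl := hU.eq
  obtain rfl := hV.eq
  refine sound_cond (fun hw => ?_) fun hw => sound_cond (fun he => ?_) fun he => ?_
  · rw [Bool.and_eq_true, isPre_iff, isPre_iff, word_prefix_iff, word_prefix_iff] at hw
    obtain ⟨⟨x, rfl⟩, y, rfl⟩ := hw
    have hL : Holds {r | r ∈ L} (r.head ++ (r.Z ++ x)) (s.head ++ (s.Z ++ y)) p ↔
        Link {r | r ∈ L} r x y := by
      by_cases he : r = s ∧ p <+: r.X
      · obtain ⟨rfl, hpX⟩ := he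
        rw [holds_of_same_head hU hV hpX, joined_prefix_iff hc]
        exact ⟨fun h => h.elim (Link.single (.refl hU.fact)) id, Or.inr⟩
      · rw [holds_of_ne_head hU hV hc hp hk he, joined_prefix_iff hc]
    simp only [Sound, Option.elim_some, Holds.nil_right]
    rw [hL, ← List.append_assoc, ← Triple.word_eq, ← List.append_assoc, ← Triple.word_eq,
      List.drop_left, List.drop_left]
    exact link_iff_activeSuffix hU.fact
  · rw [Bool.and_eq_true, isPre_iff, isPre_iff, word_prefix_iff, word_prefix_iff] at hw
    rw [Bool.and_eq_true, decide_eq_true_iff, isPre_iff] at he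
    obtain ⟨rfl, hpX⟩ := he
    simp only [Sound, Option.elim_some, Holds.nil_right, List.nil_append, List.drop_left]
    rw [holds_of_same_head hU hV hpX]
    exact ⟨fun h => h.elim id fun h => h.eqv_of_not_prefix hU.fact hw, Or.inl⟩
  · rw [Bool.and_eq_true, isPre_iff, isPre_iff] at hw
    rw [Bool.and_eq_true, decide_eq_true_iff, isPre_iff] at he
    rw [holds_of_ne_head hU hV hc hp hk he]
    exact joinStep_sound hc hw

theorem letterStep_sound (h0 : ¬ (U = [] ∧ V = []))
    (hn : (¬ ∃ r u, CleanHead {r | r ∈ L} r U u) ∨ ¬ ∃ r u, CleanHead {r | r ∈ L} r V u) :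
    Sound L U V (Holds {r | r ∈ L} U V p) (letterStep U V p) := by
  rcases U with _ | ⟨a, U⟩
  · exact fun h => h0 ⟨rfl, (holds_nil_left.1 h).1⟩
  · rcases V with _ | ⟨b, V⟩
    · refine sound_cond (fun h => by simp at h) fun _ h => ?_
      simpa using (holds_nil_middle.1 h).1
    · have hc : (!decide (a :: U = []) && decide ((a :: U).head? = (b :: V).head?) &&
          (decide (p = []) || decide (p.head? = (a :: U).head?))) = true ↔
          a = b ∧ (p = [] ∨ p.head? = some a) := by
        rw [Bool.and_eq_true, Bool.and_eq_true, Bool.or_eq_true, decide_eq_true_iff,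
          decide_eq_true_iff, decide_eq_true_iff]
        simp
      refine sound_cond (fun h => ?_) fun h => ?_
      · rw [hc] at h
        simp only [Sound, Option.elim_some]
        rw [holds_cons hn]
        exact ⟨fun h => h.2.2, fun h' => ⟨h.1, h.2, h'⟩⟩
      · rw [hc] at h
        simp only [Sound, Option.elim_none]
        rw [holds_cons hn]
        exact fun h' => h ⟨h'.1, h'.2.1⟩

theorem plan_sound (h0 : ¬ (U = [] ∧ V = [])) (hp : IsPiece {r | r ∈ L} p) :
    Sound L U V (Holds {r | r ∈ L} U V p) (plan L U V p) := by
  unfold plan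
  cases hU : headOf (table L) U with
  | none => exact letterStep_sound h0 (Or.inl (headOf_eq_none hU))
  | some r =>
    cases hV : headOf (table L) V with
    | none => exact letterStep_sound h0 (Or.inr (headOf_eq_none hV))
    | some s => exact headStep_sound (headOf_eq_some hU) (headOf_eq_some hV) hp

/-- What a reduction does to one of the words: it deletes a letter, or it deletes a prefix that
consists of a head and part of the last factor, and then puts a piece in front. -/
def Shape (L : List (List ℕ × List ℕ)) (U : List ℕ) (e : List ℕ × ℕ) : Prop :=
  (e = ([], 1) ∧ U ≠ []) ∨ (IsPiece {r | r ∈ L} e.1 ∧ ∃ r d, IsFact {r | r ∈ L} r ∧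
    r.head <+: d ∧ d <+: r.word ∧ d <+: U ∧ e.2 = d.length)

theorem headStep_shape {e : Edit} (hr : IsFact {r | r ∈ L} r) (hs : IsFact {r | r ∈ L} s)
    (hU : r.head <+: U) (hV : s.head <+: V) (h : headStep L r s U V p = some e) :
    Shape L U e.1 ∧ Shape L V e.2.1 ∧ IsPiece {r | r ∈ L} e.2.2 := by
  have shape : ∀ {t : Triple ℕ} {W : List ℕ} (z d : List ℕ), IsFact {r | r ∈ L} t →
      IsPiece {r | r ∈ L} z → d <+: t.2.2 → t.head ++ d <+: W →
      Shape L W (z, (t.head ++ d).length) := fun z d ht hz hd hW =>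
    Or.inr ⟨hz, _, _, ht, List.prefix_append _ _, (List.prefix_append_right_inj _).2 hd, hW, rfl⟩
  have shape_head : ∀ {t : Triple ℕ} {W : List ℕ} (z : List ℕ), IsFact {r | r ∈ L} t →
      IsPiece {r | r ∈ L} z → t.head <+: W → Shape L W (z, t.head.length) :=
    fun z ht hz hW => by simpa using shape z [] ht hz List.nil_prefix (by simpa using hW)
  have hnil : IsPiece {r | r ∈ L} ([] : List ℕ) := Or.inl rfl
  unfold headStep joinStep at h
  simp only [Bool.cond_eq_ite] at h
  split_ifs at h with h₁ h₂ h₃ h₄ h₅ h₆ <;> cases h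
  · rw [Bool.and_eq_true, isPre_iff, isPre_iff] at h₂
    exact ⟨shape _ _ hr (activeSuffix_piece hr) List.prefix_rfl h₂.1,
      shape _ _ hs (activeSuffix_piece hr) List.prefix_rfl h₂.2, hnil⟩
  · exact ⟨shape_head _ hr hnil hU, shape_head _ hs hnil hV, hnil⟩
  · exact ⟨shape _ _ hr hs.pieceZ List.prefix_rfl (isPre_iff.1 h₄), shape_head _ hs hnil hV, hnil⟩
  · exact ⟨shape_head _ hr hnil hU, shape _ _ hs hr.pieceZ List.prefix_rfl (isPre_iff.1 h₅), hnil⟩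
  · have e : ∀ (t : Triple ℕ) (w : List ℕ), t.head.length + commonSuffixIdx t.2.2 w =
        (t.head ++ t.2.2.take (commonSuffixIdx t.2.2 w)).length := fun t w => by
      have := @commonSuffixIdx_lt t.2.2 w
      rw [List.length_append, List.length_take]
      omega
    rw [Bool.and_eq_true, isPre_iff, isPre_iff] at h₆
    rw [e, e]
    refine ⟨shape _ _ hr hnil (List.take_prefix _ _) h₆.1,
      shape _ _ hs hnil (List.take_prefix _ _) h₆.2, ?_⟩
    have := hr.pieceZ
    rw [Triple.Z, ← List.take_append_drop (commonSuffixIdx r.2.2 s.2.2) r.2.2] at this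
    exact this.of_suffix

theorem letterStep_shape {e : Edit} (hp : IsPiece {r | r ∈ L} p)
    (h : letterStep U V p = some e) :
    Shape L U e.1 ∧ Shape L V e.2.1 ∧ IsPiece {r | r ∈ L} e.2.2 := by
  unfold letterStep at h
  simp only [Bool.cond_eq_ite] at h
  split_ifs at h with hc
  cases h
  simp only [Bool.and_eq_true, Bool.not_eq_true', decide_eq_false_iff_not,
    decide_eq_true_iff] at hc
  refine ⟨Or.inl ⟨rfl, hc.1.1⟩, Or.inl ⟨rfl, ?_⟩, ?_⟩
  · rintro rfl
    exact hc.1.1 (by simpa using hc.1.2)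
  · rcases p with _ | ⟨a, p⟩
    · exact hp
    · exact IsPiece.of_suffix (s := [a]) hp

theorem plan_shape {e : Edit} (hp : IsPiece {r | r ∈ L} p) (h : plan L U V p = some e) :
    Shape L U e.1 ∧ Shape L V e.2.1 ∧ IsPiece {r | r ∈ L} e.2.2 := by
  unfold plan at h
  cases hU : headOf (table L) U with
  | none => rw [hU] at h; exact letterStep_shape hp h
  | some r =>
    cases hV : headOf (table L) V with
    | none => rw [hU, hV] at h; exact letterStep_shape hp h
    | some s =>
      rw [hU, hV] at h
      have h₁ := headOf_eq_some hU
      have h₂ := headOf_eq_some hV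
      exact headStep_shape h₁.fact h₂.fact ⟨_, h₁.eq.symm⟩ ⟨_, h₂.eq.symm⟩ h

end Correctness

section Automaton

variable {L : List (List ℕ × List ℕ)} {n : ℕ} {s t u v p : List ℕ}

/-! ### The known parts of the words stay short -/

theorem IsPiece.length_le (h : IsPiece {r | r ∈ L} p) : p.length ≤ maxLen L := by
  rcases h with rfl | ⟨w, _, s, t, _, _, hw, -, rfl, -⟩
  · simp
  · have h := List.le_sum_of_mem (List.mem_map_of_mem (f := List.length) (mem_relWords.2 hw))
    rw [← List.length_flatten, List.length_append, List.length_append] at h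
    unfold maxLen
    omega

/-- All letters of the relations are less than `n`. -/
def LettersLT (L : List (List ℕ × List ℕ)) (n : ℕ) : Prop :=
  ∀ w, IsRelationWord {r | r ∈ L} w → ∀ a ∈ w, a < n

theorem LettersLT.piece (hL : LettersLT L n) (h : IsPiece {r | r ∈ L} p) : ∀ a ∈ p, a < n := by
  rcases h with rfl | ⟨w, _, s, t, _, _, hw, -, rfl, -⟩
  · simp
  · exact fun a ha => hL _ hw a (by simp [ha])

/-- A known part consists of a piece, which reductions have put there, and of letters that have been
read. Each reduction lowers the weight `m`, in which a letter that has been read counts for more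
than any piece. -/
def Bounded (L : List (List ℕ × List ℕ)) (n m : ℕ) (s : List ℕ) : Prop :=
  (∃ z w, s = z ++ w ∧ IsPiece {r | r ∈ L} z ∧ w.length ≤ lookahead L ∧
    (maxLen L + 1) * w.length + z.length < m) ∧ ∀ a ∈ s, a ≤ n

theorem Bounded.full {m : ℕ} (h : Bounded L n m s) : Bounded L n (reductionBound L) s := by
  obtain ⟨⟨z, w, e, hz, hw, -⟩, h⟩ := h
  refine ⟨⟨z, w, e, hz, hw, ?_⟩, h⟩
  have h₁ := hz.length_le
  have h₂ : (maxLen L + 1) * w.length ≤ (maxLen L + 1) * lookahead L := Nat.mul_le_mul_left _ hw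
  rw [reductionBound, Nat.mul_add]
  omega

theorem Bounded.length_le {m : ℕ} (h : Bounded L n m s) :
    s.length ≤ maxLen L + lookahead L := by
  obtain ⟨⟨z, w, rfl, hz, hw, -⟩, -⟩ := h
  have := hz.length_le
  rw [List.length_append]
  omega

theorem Bounded.read {m a : ℕ} (h : Bounded L n m s) (hs : s.length < lookahead L)
    (ha : a ≤ n) : Bounded L n (reductionBound L) (s ++ [a]) := by
  obtain ⟨⟨z, w, rfl, hz, hw, -⟩, h⟩ := h
  rw [List.length_append] at hs
  refine Bounded.full (m := (maxLen L + 1) * (w ++ [a]).length + z.length + 1)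
    ⟨⟨z, w ++ [a], by simp, hz, ?_, by omega⟩, ?_⟩
  · rw [List.length_append, List.length_singleton]; omega
  · intro b hb
    rcases List.mem_append.1 hb with hb | hb
    · exact h b hb
    · rw [List.mem_singleton.1 hb]; exact ha

theorem Bounded.shape {m : ℕ} {e : List ℕ × ℕ} (hL : LettersLT L n) (h : Bounded L n (m + 1) s)
    (he : Shape L s e) : Bounded L n m (e.1 ++ s.drop e.2) := by
  obtain ⟨⟨z, w, rfl, hz, hw, hm⟩, hl⟩ := h
  rcases he with ⟨rfl, hne⟩ | ⟨hp, r, d, hr, hrd, -, hds, he⟩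
  · refine ⟨?_, fun a ha => hl a (List.drop_subset _ _ ha)⟩
    rcases z with _ | ⟨b, z⟩
    · rcases w with _ | ⟨b, w⟩
      · simp at hne
      · refine ⟨[], w, by simp, Or.inl rfl, ?_, ?_⟩
        · rw [List.length_cons] at hw; omega
        · rw [List.length_cons, Nat.mul_add] at hm
          simp only [List.length_nil] at hm ⊢
          omega
    · refine ⟨z, w, by simp, IsPiece.of_suffix (s := [b]) hz, hw, ?_⟩
      rw [List.length_cons] at hm; omega
  · -- the old piece lies within `X`, so that a letter that has been read is deleted with `Y`
    obtain ⟨q, hq⟩ := hrd.trans hds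
    obtain ⟨k, hk, -⟩ := hr.prefix_X hz hq.symm
    have hlen : z.length + 1 ≤ e.2 := by
      have h₁ := hrd.length_le
      have h₂ := List.length_pos_iff.2 hr.Y_ne_nil
      rw [Triple.head, hk, List.length_append, List.length_append] at h₁
      omega
    have hw0 : 1 ≤ w.length := by
      have := hds.length_le
      rw [List.length_append] at this
      omega
    have hdrop : (z ++ w).drop e.2 = w.drop (e.2 - z.length) := by
      rw [List.drop_append, List.drop_eq_nil_of_le (by omega), List.nil_append]
    refine ⟨⟨e.1, w.drop (e.2 - z.length), by rw [hdrop], hp, ?_, ?_⟩, fun a ha => ?_⟩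
    · rw [List.length_drop]; omega
    · have h₁ : (w.drop (e.2 - z.length)).length + 1 ≤ w.length := by
        rw [List.length_drop]; omega
      have h₂ := Nat.mul_le_mul_left (maxLen L + 1) h₁
      rw [Nat.mul_add] at h₂
      have := hp.length_le
      omega
    · rcases List.mem_append.1 ha with ha | ha
      · exact (hL.piece hp a ha).le
      · exact hl a (List.drop_subset _ _ ha)

/-- The known part `s` and the unread part `u` of a word together end in the only end-marker, or
everything has been processed. -/
def TapeOK (n : ℕ) (s u : List ℕ) : Prop :=
  (s = [] ∧ u = []) ∨ ∃ a, s ++ u = a ++ [n] ∧ n ∉ a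

theorem TapeOK.unread_nil (h : TapeOK n s u) (hs : n ∈ s) : u = [] := by
  rcases h with ⟨-, h⟩ | ⟨a, e, ha⟩
  · exact h
  · rcases List.eq_nil_or_concat u with h | ⟨u', b, rfl⟩
    · exact h
    · rw [List.concat_eq_append, ← List.append_assoc] at e
      obtain ⟨rfl, -⟩ := List.append_inj' e rfl
      exact absurd (List.mem_append_left _ hs) ha

theorem TapeOK.nil_of_unread_nil (h : TapeOK n s []) (hs : n ∉ s) : s = [] := by
  rcases h with ⟨h, -⟩ | ⟨a, e, -⟩
  · exact h
  · rw [List.append_nil] at e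
    exact absurd (by simp [e]) hs

theorem TapeOK.shape {e : List ℕ × ℕ} (hL : LettersLT L n) (h : TapeOK n s u)
    (he : Shape L s e) : TapeOK n (e.1 ++ s.drop e.2) u := by
  obtain ⟨z, i⟩ := e
  rcases he with ⟨he, hne⟩ | ⟨hp, r, d, hr, hrd, hdr, ⟨s', rfl⟩, he⟩
  · obtain ⟨rfl, rfl⟩ := Prod.mk.inj he
    rcases s with _ | ⟨b, s⟩
    · exact absurd rfl hne
    · rcases h with ⟨h, -⟩ | ⟨a, e, ha⟩
      · cases h
      · rcases a with _ | ⟨c, a⟩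
        · left
          simpa using (List.cons.inj e).2
        · exact Or.inr ⟨a, by simpa using (List.cons.inj e).2, fun h => ha (by simp [h])⟩
  · obtain rfl : i = d.length := he
    rw [List.drop_left]
    obtain ⟨k, hk⟩ := hdr
    have hd : ∀ a ∈ d, a < n := fun a ha => hL _ hr.word a (by simp [← hk, ha])
    have hd0 : d ≠ [] := fun h => hr.head_ne_nil (List.prefix_nil.1 (h ▸ hrd))
    rcases h with ⟨h, -⟩ | ⟨a, e, ha⟩
    · exact absurd (List.append_eq_nil_iff.1 h).1 hd0
    · rw [List.append_assoc] at e
      rcases List.append_eq_append_iff.1 e with ⟨m, rfl, h₂⟩ | ⟨m, rfl, h₂⟩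
      · refine Or.inr ⟨z ++ m, by simp [h₂], ?_⟩
        rw [List.mem_append, not_or]
        exact ⟨fun h => (hL.piece hp _ h).ne rfl, fun h => ha (by simp [h])⟩
      · rcases m with _ | ⟨b, m⟩
        · refine Or.inr ⟨z, by simpa using h₂.symm, fun h => (hL.piece hp _ h).ne rfl⟩
        · obtain ⟨rfl, -⟩ := List.cons.inj h₂
          exact absurd (hd n (by simp)) (lt_irrefl n)

theorem short_iff : short L n s = true ↔ s.length < lookahead L ∧ n ∉ s := by
  rw [short, Bool.and_eq_true, decide_eq_true_iff, List.all_eq_true]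
  refine and_congr_right fun _ => ⟨fun h hn => by simpa using h n hn, fun h a ha => ?_⟩
  simp only [Bool.not_eq_true', decide_eq_false_iff_not]
  rintro rfl
  exact h ha

theorem short_nil : short L n [] = true := short_iff.2 ⟨Nat.succ_pos _, by simp⟩

theorem Shape.of_take {U : List ℕ} {e : List ℕ × ℕ} {K : ℕ} (h : Shape L (U.take K) e) :
    Shape L U e := by
  rcases h with ⟨h, hne⟩ | ⟨hp, r, d, hr, h₁, h₂, h₃, h₄⟩
  · exact Or.inl ⟨h, fun h => hne (by simp [h])⟩
  · exact Or.inr ⟨hp, r, d, hr, h₁, h₂, h₃.trans (List.take_prefix _ _), h₄⟩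

theorem Shape.le_length {U : List ℕ} {e : List ℕ × ℕ} (h : Shape L U e) : e.2 ≤ U.length := by
  rcases h with ⟨rfl, hne⟩ | ⟨hp, r, d, hr, h₁, h₂, h₃, h₄⟩
  · exact List.length_pos_iff.2 hne
  · exact h₄ ▸ h₃.length_le

/-! ### Correctness of the transitions -/

/-- The statement decided by the automaton from the state `st` on, with `u` and `v` unread. -/
def Truth (L : List (List ℕ × List ℕ)) (u v : List ℕ) (st : State) : Prop :=
  Holds {r | r ∈ L} (st.1 ++ u) (st.2.1 ++ v) st.2.2

/-- The invariant of the configurations of the automaton. -/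
structure Good (L : List (List ℕ × List ℕ)) (n m : ℕ) (u v : List ℕ) (st : State) : Prop where
  bounded₁ : Bounded L n m st.1
  bounded₂ : Bounded L n (reductionBound L) st.2.1
  piece : IsPiece {r | r ∈ L} st.2.2
  tape₁ : TapeOK n st.1 u
  tape₂ : TapeOK n st.2.1 v

theorem take_append_of_not_short (hs : ¬ short L n s = true) (h : TapeOK n s u) :
    (s ++ u).take (lookahead L) = s.take (lookahead L) := by
  rw [short_iff, not_and_or, not_not] at hs
  rcases hs with hs | hs
  · rw [List.take_append_of_le_length (by omega)]
  · rw [h.unread_nil hs, List.append_nil]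

/-- If neither known part is short, they determine the reduction, for they are long enough or reach
to the end-marker. -/
theorem reduce_spec {m : ℕ} {st : State} (hL : LettersLT L n) (hG : Good L n (m + 1) u v st)
    (h₁ : ¬ short L n st.1 = true) (h₂ : ¬ short L n st.2.1 = true) :
    (reduce L st = none ∧ ¬ Truth L u v st) ∨
      ∃ st', reduce L st = some st' ∧ Good L n m u v st' ∧
        (Truth L u v st ↔ Truth L u v st') := by
  obtain ⟨s, t, p⟩ := st
  have h0 : ¬ (s ++ u = [] ∧ t ++ v = []) := fun h => by
    obtain ⟨rfl, -⟩ := List.append_eq_nil_iff.1 h.1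
    exact h₁ short_nil
  have hplan : plan L (s.take (lookahead L)) (t.take (lookahead L)) p =
      plan L (s ++ u) (t ++ v) p := by
    rw [← take_append_of_not_short h₁ hG.tape₁, ← take_append_of_not_short h₂ hG.tape₂,
      plan_take]
  have hsound := plan_sound h0 hG.piece
  cases hp : plan L (s ++ u) (t ++ v) p with
  | none =>
    rw [hp] at hsound
    exact Or.inl ⟨by simp only [reduce, hplan, hp, Option.bind_none], hsound⟩
  | some e =>
    rw [hp] at hsound
    rw [hp] at hplan
    obtain ⟨sh₁, sh₂, hpc⟩ := plan_shape hG.piece hplan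
    have sh₁ := sh₁.of_take
    have sh₂ := sh₂.of_take
    refine Or.inr ⟨(e.1.1 ++ s.drop e.1.2, e.2.1.1 ++ t.drop e.2.1.2, e.2.2),
      by simp only [reduce, hplan, Option.bind_some], ⟨hG.bounded₁.shape hL sh₁, ?_, hpc,
        hG.tape₁.shape hL sh₁, hG.tape₂.shape hL sh₂⟩, ?_⟩
    · obtain ⟨k, hk⟩ : ∃ k, reductionBound L = k + 1 :=
        Nat.exists_eq_add_one_of_ne_zero (by simp [reductionBound])
      have := hG.bounded₂
      rw [hk] at this
      exact (this.shape hL sh₂).full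
    · simp only [Sound, Option.elim_some] at hsound
      rw [List.drop_append_of_le_length sh₁.le_length,
        List.drop_append_of_le_length sh₂.le_length, ← List.append_assoc, ← List.append_assoc]
        at hsound
      exact hsound

/-- A known part of weight less than `m` admits fewer than `m` reductions, so that after `N ≥ m`
attempts a word has to be read further, or the statement has been refuted. -/
theorem iterate_spec (hL : LettersLT L n) (N : ℕ) {m : ℕ} {st : State}
    (hG : Good L n m u v st) (hm : m ≤ N) :
    ((tryReduce L n)^[N] (some st) = none ∧ ¬ Truth L u v st) ∨
      ∃ st', (tryReduce L n)^[N] (some st) = some st' ∧ Good L n (reductionBound L) u v st' ∧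
        (short L n st'.1 = true ∨ short L n st'.2.1 = true) ∧
        (Truth L u v st ↔ Truth L u v st') := by
  induction N generalizing m st with
  | zero =>
    obtain ⟨⟨z, w, -, -, -, h⟩, -⟩ := hG.bounded₁
    omega
  | succ N ih =>
    by_cases hs : short L n st.1 = true ∨ short L n st.2.1 = true
    · have hfix : tryReduce L n (some st) = some st := by
        simp only [tryReduce, Option.bind_some]
        rw [Bool.or_eq_true_iff.2 hs, cond_true]
      exact Or.inr ⟨st, Function.iterate_fixed hfix _,
        ⟨hG.bounded₁.full, hG.bounded₂, hG.piece, hG.tape₁, hG.tape₂⟩, hs, Iff.rfl⟩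
    · have hred : tryReduce L n (some st) = reduce L st := by
        simp only [tryReduce, Option.bind_some]
        rw [← Bool.or_eq_true, Bool.not_eq_true] at hs
        rw [hs, cond_false]
      rw [not_or] at hs
      rw [Function.iterate_succ_apply, hred]
      obtain ⟨k, rfl⟩ : ∃ k, m = k + 1 := by
        obtain ⟨⟨z, w, -, -, -, h⟩, -⟩ := hG.bounded₁
        exact Nat.exists_eq_add_one_of_ne_zero (by omega)
      rcases reduce_spec hL hG hs.1 hs.2 with ⟨h, hT⟩ | ⟨st', h, hG', hT⟩
      · rw [h]
        exact Or.inl ⟨Function.iterate_fixed rfl _, hT⟩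
      · rw [h, hT]
        exact ih hG' (by omega)

/-- What is required of the result of reading a letter from the state `st`, `T` being the statement
to be decided, and `u`, `v` remaining unread. -/
def NextOK (L : List (List ℕ × List ℕ)) (n : ℕ) (u v : List ℕ) (T : Prop) (o : Option State) :
    Prop :=
  (o = none ∧ ¬ T) ∨ ∃ st, o = some st ∧ Good L n (reductionBound L) u v st ∧
    (short L n st.1 = true ∨ short L n st.2.1 = true) ∧ (T ↔ Truth L u v st)

theorem TapeOK.read {a : ℕ} (h : TapeOK n s (a :: u)) : TapeOK n (s ++ [a]) u := by
  rcases h with ⟨-, h⟩ | ⟨b, e, hb⟩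
  · cases h
  · exact Or.inr ⟨b, by simpa using e, hb⟩

theorem next_spec₁ {st : State} {a : ℕ} (hL : LettersLT L n)
    (hG : Good L n (reductionBound L) (a :: u) v st) (hs : short L n st.1 = true) (ha : a ≤ n) :
    NextOK L n u v (Truth L (a :: u) v st) (next L n st a) := by
  have hT : Truth L (a :: u) v st ↔ Truth L u v (st.1 ++ [a], st.2) := by
    simp [Truth]
  rw [hT, next, hs, cond_true]
  exact iterate_spec hL _ ⟨hG.bounded₁.read (short_iff.1 hs).1 ha, hG.bounded₂, hG.piece,
    hG.tape₁.read, hG.tape₂⟩ le_rfl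

theorem next_spec₂ {st : State} {a : ℕ} (hL : LettersLT L n)
    (hG : Good L n (reductionBound L) u (a :: v) st) (hs₁ : ¬ short L n st.1 = true)
    (hs : short L n st.2.1 = true) (ha : a ≤ n) :
    NextOK L n u v (Truth L u (a :: v) st) (next L n st a) := by
  have hT : Truth L u (a :: v) st ↔ Truth L u v (st.1, st.2.1 ++ [a], st.2.2) := by
    simp [Truth]
  rw [Bool.not_eq_true] at hs₁
  rw [hT, next, hs₁, hs, cond_false, cond_true]
  exact iterate_spec hL _ ⟨hG.bounded₁, hG.bounded₂.read (short_iff.1 hs).1 ha, hG.piece,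
    hG.tape₁, hG.tape₂.read⟩ le_rfl

/-! ### The states -/

theorem mem_wordsUpTo {m : ℕ} {w : List ℕ} :
    w ∈ wordsUpTo n m ↔ w.length ≤ m ∧ ∀ a ∈ w, a ≤ n := by
  induction m generalizing w with
  | zero => cases w <;> simp [wordsUpTo]
  | succ m ih =>
    rw [wordsUpTo, Function.iterate_succ_apply', ← wordsUpTo]
    rcases w with _ | ⟨a, w⟩
    · simp
    · simp [ih, and_comm, and_assoc, and_left_comm]

theorem Good.mem_allStates {m : ℕ} {st : State} (hL : LettersLT L n) (h : Good L n m u v st) :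
    st ∈ allStates L n := by
  simp only [allStates, List.mem_flatMap, List.mem_map, mem_wordsUpTo]
  exact ⟨st.1, ⟨h.bounded₁.length_le, h.bounded₁.2⟩, st.2.1,
    ⟨h.bounded₂.length_le, h.bounded₂.2⟩, st.2.2,
    ⟨h.piece.length_le.trans (Nat.le_add_right _ _), fun a ha => (hL.piece h.piece a ha).le⟩, rfl⟩

end Automaton

section Recognises

open AutomatonCode

variable {L : List (List ℕ × List ℕ)} {n : ℕ}

/-! ### The automaton -/

theorem start_mem_allStates : (([], [], []) : State) ∈ allStates L n := by
  simp [allStates, mem_wordsUpTo]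

theorem encode_mem_states {st : State} :
    Encodable.encode st ∈ states (automaton n L) ↔ st ∈ allStates L n :=
  List.mem_map_of_injective Encodable.encode_injective

/-- The transition function on the states of the automaton, for either tape. -/
def delta (L : List (List ℕ × List ℕ)) (n : ℕ) (q : {q : ℕ // q ∈ states (automaton n L)})
    (a : EndMarked (Fin n)) : Option {q : ℕ // q ∈ states (automaton n L)} :=
  ((Encodable.decode (α := State) (q : ℕ)).bind fun st => next L n st (a.elim n Fin.val)).bind
    fun st' => if h : st' ∈ allStates L n then some ⟨_, encode_mem_states.2 h⟩ else none

/-- The automaton described by the code `automaton n L`. -/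
def dfa (L : List (List ℕ × List ℕ)) (n : ℕ) :
    TwoTapeDFA (Fin n) (Fin n) {q : ℕ // q ∈ states (automaton n L)} where
  Q₁ := {q | (q : ℕ) ∈ firstTape (automaton n L)}
  start := ⟨_, encode_mem_states.2 start_mem_allStates⟩
  terminal := {q | (q : ℕ) ∈ terminal (automaton n L)}
  δ₁ q := delta L n q
  δ₂ q := delta L n q

theorem delta_eq_some_iff {st : State} {h : Encodable.encode st ∈ states (automaton n L)}
    {a : EndMarked (Fin n)} {q : {q : ℕ // q ∈ states (automaton n L)}} :
    delta L n ⟨_, h⟩ a = some q ↔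
      ∃ st' ∈ allStates L n, next L n st (a.elim n Fin.val) = some st' ∧
        (q : ℕ) = Encodable.encode st' := by
  simp only [delta, Encodable.encodek, Option.bind_some, Option.bind_eq_some_iff]
  constructor
  · rintro ⟨st', h, h'⟩
    split_ifs at h' with hm
    cases h'
    exact ⟨st', hm, h, rfl⟩
  · rintro ⟨st', hm, h, e⟩
    exact ⟨st', h, by rw [dif_pos hm]; exact congrArg some (Subtype.ext e.symm)⟩

theorem mem_transitions_iff {p q : {q : ℕ // q ∈ states (automaton n L)}}
    {a : EndMarked (Fin n)} :
    ((p : ℕ), a.map Fin.val, (q : ℕ)) ∈ transitions (automaton n L) ↔ delta L n p a = some q := by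
  obtain ⟨p, hp⟩ := p
  obtain ⟨st, hst, rfl⟩ := List.mem_map.1 hp
  have helim : (a.map Fin.val).elim n id = a.elim n Fin.val := by cases a <;> rfl
  have hsymb : a.map Fin.val ∈ symbols n := by cases a <;> simp [symbols]
  rw [delta_eq_some_iff]
  simp only [transitions, automaton, List.mem_flatMap, List.mem_map, List.mem_filter,
    Option.mem_toList, List.any_eq_true, decide_eq_true_iff, Prod.mk.injEq]
  constructor
  · rintro ⟨st₀, -, b, -, st', ⟨h₁, x, hx, rfl⟩, e₁, rfl, e₂⟩
    rw [Encodable.encode_injective e₁, helim] at h₁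
    exact ⟨st', hx, h₁, e₂.symm⟩
  · rintro ⟨st', hm, h, e⟩
    exact ⟨st, hst, _, hsymb, st', ⟨by rw [helim]; exact h, st', hm, rfl⟩, rfl, rfl, e.symm⟩

theorem describes_dfa : Describes (automaton n L) (dfa L n) where
  firstTape_iff _ := Iff.rfl
  start_eq := rfl
  terminal_iff _ := Iff.rfl
  δ₁_iff _ _ _ _ := mem_transitions_iff
  δ₂_iff _ _ _ _ := mem_transitions_iff

theorem mem_Q₁_iff {st : State} (hst : st ∈ allStates L n)
    {h : Encodable.encode st ∈ states (automaton n L)} :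
    (⟨_, h⟩ : {q : ℕ // q ∈ states (automaton n L)}) ∈ (dfa L n).Q₁ ↔
      short L n st.1 = true := by
  have : Encodable.encode st ∈ firstTape (automaton n L) ↔
      st ∈ (allStates L n).filter fun st => short L n st.1 :=
    List.mem_map_of_injective Encodable.encode_injective
  refine this.trans ?_
  rw [List.mem_filter]
  exact and_iff_right hst

theorem mem_terminal_iff {q : {q : ℕ // q ∈ states (automaton n L)}} :
    q ∈ (dfa L n).terminal ↔ q = ⟨_, encode_mem_states.2 start_mem_allStates⟩ := by
  rw [Subtype.ext_iff]
  exact List.mem_singleton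

/-- The word over the natural numbers read from a tape. -/
def tapeWord (u : List (EndMarked (Fin n))) : List ℕ := u.map fun a => a.elim n Fin.val

theorem elim_le (a : EndMarked (Fin n)) : a.elim n Fin.val ≤ n := by
  cases a with
  | none => exact le_rfl
  | some a => exact a.2.le

theorem step_iff₁ {st : State} {u v : List (EndMarked (Fin n))}
    {c : List (EndMarked (Fin n)) × List (EndMarked (Fin n)) × _}
    (hs : short L n st.1 = true) (h : Encodable.encode st ∈ states (automaton n L)) :
    (dfa L n).Step (u, v, ⟨_, h⟩) c ↔ ∃ a u' st', ∃ h' : st' ∈ allStates L n, u = a :: u' ∧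
      next L n st (a.elim n Fin.val) = some st' ∧ c = (u', v, ⟨_, encode_mem_states.2 h'⟩) := by
  have hQ := (mem_Q₁_iff (encode_mem_states.1 h) (h := h)).2 hs
  constructor
  · intro hstep
    cases hstep with
    | tape₁ a u v p q hp hd =>
      obtain ⟨st', hm, hn, e⟩ := delta_eq_some_iff.1 hd
      exact ⟨a, u, st', hm, rfl, hn, Prod.ext rfl (Prod.ext rfl (Subtype.ext e))⟩
    | tape₂ b u v p q hp hd => exact absurd hQ hp
  · rintro ⟨a, u', st', hm, rfl, hn, rfl⟩
    exact .tape₁ a u' v _ _ hQ (delta_eq_some_iff.2 ⟨st', hm, hn, rfl⟩)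

theorem step_iff₂ {st : State} {u v : List (EndMarked (Fin n))}
    {c : List (EndMarked (Fin n)) × List (EndMarked (Fin n)) × _}
    (hs : ¬ short L n st.1 = true) (h : Encodable.encode st ∈ states (automaton n L)) :
    (dfa L n).Step (u, v, ⟨_, h⟩) c ↔ ∃ a v' st', ∃ h' : st' ∈ allStates L n, v = a :: v' ∧
      next L n st (a.elim n Fin.val) = some st' ∧ c = (u, v', ⟨_, encode_mem_states.2 h'⟩) := by
  have hQ := mt (mem_Q₁_iff (encode_mem_states.1 h) (h := h)).1 hs
  constructor
  · intro hstep
    cases hstep with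
    | tape₁ a u v p q hp hd => exact absurd hp hQ
    | tape₂ b u v p q hp hd =>
      obtain ⟨st', hm, hn, e⟩ := delta_eq_some_iff.1 hd
      exact ⟨b, v, st', hm, rfl, hn, Prod.ext rfl (Prod.ext rfl (Subtype.ext e))⟩
  · rintro ⟨a, v', st', hm, rfl, hn, rfl⟩
    exact .tape₂ a u v' _ _ hQ (delta_eq_some_iff.2 ⟨st', hm, hn, rfl⟩)

/-- The automaton started in the state `st` accepts if and only if what this state stands for is
true. -/
theorem run_iff (hL : LettersLT L n) (u v : List (EndMarked (Fin n))) {st : State}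
    (hG : Good L n (reductionBound L) (tapeWord u) (tapeWord v) st)
    (hs : short L n st.1 = true ∨ short L n st.2.1 = true)
    (h : Encodable.encode st ∈ states (automaton n L)) :
    Relation.ReflTransGen (dfa L n).Step (u, v, ⟨_, h⟩)
        ([], [], ⟨_, encode_mem_states.2 start_mem_allStates⟩) ↔
      Truth L (tapeWord u) (tapeWord v) st := by
  induction hN : u.length + v.length using Nat.strong_induction_on generalizing u v st with
  | _ N ih =>
  subst hN
  -- the decision is left to the configuration reached by reading a letter
  have key : ∀ {u' v' : List (EndMarked (Fin n))} {o : Option State},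
      u'.length + v'.length < u.length + v.length →
      NextOK L n (tapeWord u') (tapeWord v') (Truth L (tapeWord u) (tapeWord v) st) o →
      (∀ c, (dfa L n).Step (u, v, ⟨_, h⟩) c ↔ ∃ st', ∃ h' : st' ∈ allStates L n,
        o = some st' ∧ c = (u', v', ⟨_, encode_mem_states.2 h'⟩)) →
      (Relation.ReflTransGen (dfa L n).Step (u, v, ⟨_, h⟩)
          ([], [], ⟨_, encode_mem_states.2 start_mem_allStates⟩) ↔
        Truth L (tapeWord u) (tapeWord v) st) := by
    intro u' v' o hlt hok hstep
    have hne : ¬ ((u, v, ⟨_, h⟩) : _ × _ × {q : ℕ // q ∈ states (automaton n L)}) =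
        ([], [], ⟨_, encode_mem_states.2 start_mem_allStates⟩) := fun e => by
      simp only [Prod.mk.injEq] at e
      simp [e.1, e.2.1] at hlt
    rw [Relation.ReflTransGen.cases_head_iff, or_iff_right hne]
    rcases hok with ⟨rfl, hT⟩ | ⟨st', rfl, hG', hs', hT⟩
    · refine iff_of_false ?_ hT
      rintro ⟨c, hc, -⟩
      obtain ⟨_, _, e, -⟩ := (hstep c).1 hc
      cases e
    · have hm := hG'.mem_allStates hL
      rw [hT, ← ih _ hlt u' v' hG' hs' (encode_mem_states.2 hm) rfl]
      constructor
      · rintro ⟨c, hc, hr⟩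
        obtain ⟨_, _, e, rfl⟩ := (hstep c).1 hc
        cases e
        exact hr
      · exact fun hr => ⟨_, (hstep _).2 ⟨st', hm, rfl, rfl⟩, hr⟩
  by_cases h₁ : short L n st.1 = true
  · rcases u with _ | ⟨a, u⟩
    · have e₁ : st.1 = [] := hG.tape₁.nil_of_unread_nil (short_iff.1 h₁).2
      have hstep : ¬ ∃ c, (dfa L n).Step ([], v, ⟨_, h⟩) c ∧ Relation.ReflTransGen (dfa L n).Step c
          ([], [], ⟨_, encode_mem_states.2 start_mem_allStates⟩) := by
        rintro ⟨c, hc, -⟩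
        obtain ⟨_, _, _, _, e, -⟩ := (step_iff₁ h₁ h).1 hc
        cases e
      rw [Relation.ReflTransGen.cases_head_iff, or_iff_left hstep, Truth, e₁]
      obtain ⟨s, t, p⟩ := st
      have e₁ : s = [] := e₁
      subst e₁
      rw [show ([] : List ℕ) ++ tapeWord ([] : List (EndMarked (Fin n))) = [] from rfl,
        holds_nil_left]
      simp only [Prod.mk.injEq, true_and, Subtype.mk.injEq, Encodable.encode_inj,
        List.append_eq_nil_iff, tapeWord, List.map_eq_nil_iff]
      tauto
    · refine key (u' := u) (v' := v) (by simp) (next_spec₁ hL hG h₁ (elim_le a)) fun c => ?_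
      rw [step_iff₁ h₁ h]
      constructor
      · rintro ⟨_, _, st', hm, e, hn, rfl⟩
        cases e
        exact ⟨st', hm, hn, rfl⟩
      · rintro ⟨st', hm, hn, rfl⟩
        exact ⟨a, u, st', hm, rfl, hn, rfl⟩
  · have h₂ := hs.resolve_left h₁
    rcases v with _ | ⟨a, v⟩
    · have hne : st.1 ≠ [] := fun e => h₁ (e ▸ short_nil)
      refine iff_of_false ?_ fun hT => ?_
      · rw [Relation.ReflTransGen.cases_head_iff]
        rintro (e | ⟨c, hc, -⟩)
        · simp only [Prod.mk.injEq, Subtype.mk.injEq, Encodable.encode_inj] at e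
          exact hne (by rw [e.2.2])
        · obtain ⟨_, _, _, _, e, -⟩ := (step_iff₂ h₁ h).1 hc
          cases e
      · have e₂ : st.2.1 = [] := hG.tape₂.nil_of_unread_nil (short_iff.1 h₂).2
        rw [Truth, e₂] at hT
        exact hne (List.append_eq_nil_iff.1 (holds_nil_middle.1 hT).1).1
    · refine key (u' := u) (v' := v) (by simp) (next_spec₂ hL hG h₁ h₂ (elim_le a)) fun c => ?_
      rw [step_iff₂ h₁ h]
      constructor
      · rintro ⟨_, _, st', hm, e, hn, rfl⟩
        cases e
        exact ⟨st', hm, hn, rfl⟩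
      · rintro ⟨st', hm, hn, rfl⟩
        exact ⟨a, v, st', hm, rfl, hn, rfl⟩

theorem tapeWord_endMark (u : List (Fin n)) : tapeWord (endMark u) = u.map Fin.val ++ [n] := by
  rw [tapeWord, endMark, List.map_append, List.map_map]
  rfl

theorem tapeOK_endMark (u : List (Fin n)) : TapeOK n [] (tapeWord (endMark u)) :=
  Or.inr ⟨u.map Fin.val, tapeWord_endMark u, fun h => by
    obtain ⟨a, -, ha⟩ := List.mem_map.1 h
    exact absurd a.2 (by rw [ha]; exact lt_irrefl n)⟩

/-- The end-marker is read as the letter `n`. -/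
theorem mem_accepts_dfa (hL : LettersLT L n) (u v : List (Fin n)) :
    (u, v) ∈ (dfa L n).accepts ↔
      Eqv {r | r ∈ L} (u.map Fin.val ++ [n]) (v.map Fin.val ++ [n]) := by
  have hb : Bounded L n (reductionBound L) [] :=
    Bounded.full (m := 1) ⟨⟨[], [], rfl, Or.inl rfl, by simp, by simp⟩, by simp⟩
  have hrun := run_iff (st := ([], [], [])) hL (endMark u) (endMark v)
    ⟨hb, hb, Or.inl rfl, tapeOK_endMark u, tapeOK_endMark v⟩ (Or.inl short_nil)
    (encode_mem_states.2 start_mem_allStates)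
  have hT : Truth L (tapeWord (endMark u)) (tapeWord (endMark v)) ([], [], []) ↔
      Eqv {r | r ∈ L} (u.map Fin.val ++ [n]) (v.map Fin.val ++ [n]) := by
    rw [Truth, Holds.nil_right, tapeWord_endMark, tapeWord_endMark]
    rfl
  rw [← hT, ← hrun]
  constructor
  · rintro ⟨q, hq, h⟩
    rw [mem_terminal_iff.1 hq] at h
    exact h
  · exact fun h => ⟨_, mem_terminal_iff.2 rfl, h⟩

end Recognises

section Transfer

variable {A B : Type*} {R : Set (List A × List A)}

/-! ### Change of alphabet -/

/-- The relations obtained by applying `φ` to each letter. -/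
def mapRel (φ : A → B) (R : Set (List A × List A)) : Set (List B × List B) :=
  Prod.map (List.map φ) (List.map φ) '' R

theorem mem_mapRel {φ : A → B} {x y : List B} :
    (x, y) ∈ mapRel φ R ↔ ∃ x' y', (x', y') ∈ R ∧ x = x'.map φ ∧ y = y'.map φ := by
  simp [mapRel, eq_comm]

theorem IsRelationWord.of_mapRel {φ : A → B} {w : List B} (h : IsRelationWord (mapRel φ R) w) :
    ∃ w', IsRelationWord R w' ∧ w = w'.map φ := by
  obtain ⟨x, h⟩ := h
  simp only [mem_mapRel] at h
  rcases h with ⟨x', y', h, rfl, -⟩ | ⟨x', y', h, -, rfl⟩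
  · exact ⟨x', ⟨y', Or.inl h⟩, rfl⟩
  · exact ⟨y', ⟨x', Or.inr h⟩, rfl⟩

theorem IsPiece.of_mapRel {φ : A → B} (hφ : Function.Injective φ) {p : List B}
    (h : IsPiece (mapRel φ R) p) : ∃ p', IsPiece R p' ∧ p = p'.map φ := by
  rcases h with rfl | ⟨w₁, w₂, s₁, t₁, s₂, t₂, h₁, h₂, e₁, e₂, hne⟩
  · exact ⟨[], Or.inl rfl, rfl⟩
  · obtain ⟨w₁, h₁', rfl⟩ := h₁.of_mapRel
    obtain ⟨w₂, h₂', rfl⟩ := h₂.of_mapRel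
    rw [List.map_eq_append_iff] at e₁ e₂
    obtain ⟨v₁, t₁, rfl, e₁, rfl⟩ := e₁
    obtain ⟨v₂, t₂, rfl, e₂, rfl⟩ := e₂
    rw [List.map_eq_append_iff] at e₁ e₂
    obtain ⟨s₁, p₁, rfl, rfl, rfl⟩ := e₁
    obtain ⟨s₂, p₂, rfl, rfl, e⟩ := e₂
    obtain rfl := List.map_injective_iff.2 hφ e
    refine ⟨p₂, Or.inr ⟨_, _, s₁, t₁, s₂, t₂, h₁', h₂', rfl, rfl, ?_⟩, rfl⟩
    exact hne.imp (fun h e => h (by rw [e])) fun h e => h (by rw [e])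

theorem SatisfiesC.mapRel {φ : A → B} (hφ : Function.Injective φ) {m : ℕ}
    (hC : SatisfiesC m R) : SatisfiesC m (mapRel φ R) := by
  rintro _ hw ⟨ps, hlen, hps, hflat⟩
  obtain ⟨w, hw', rfl⟩ := hw.of_mapRel
  have : ∃ qs : List (List A), ps = qs.map (List.map φ) ∧ ∀ q ∈ qs, IsPiece R q := by
    clear hlen hflat
    induction ps with
    | nil => exact ⟨[], rfl, by simp⟩
    | cons p ps ih =>
      obtain ⟨qs, rfl, hqs⟩ := ih fun p hp => hps p (by simp [hp])
      obtain ⟨q, hq, rfl⟩ := (hps p (by simp)).of_mapRel hφ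
      exact ⟨q :: qs, rfl, by simpa using ⟨hq, hqs⟩⟩
  obtain ⟨qs, rfl, hqs⟩ := this
  refine hC w hw' ⟨qs, by simpa using hlen, hqs, ?_⟩
  rw [← List.map_flatten] at hflat
  exact List.map_injective_iff.2 hφ hflat

theorem SatisfiesC.ne_nil {m : ℕ} (hC : SatisfiesC (m + 1) R) {w : List A}
    (hw : IsRelationWord R w) : w ≠ [] :=
  fun h => hC w hw ⟨[], by simp, by simp, h.symm⟩

/-- A word that shares no letters with the relations remains unchanged at the end of a word. -/
theorem OneStep.of_mapRel {φ : A → B} (hφ : Function.Injective φ)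
    (hne : ∀ w, IsRelationWord R w → w ≠ []) {t : List B} (ht : ∀ a, φ a ∉ t) {u : List A}
    {w : List B} (h : OneStep (mapRel φ R) (u.map φ ++ t) w) :
    ∃ v, w = v.map φ ++ t ∧ OneStep R u v := by
  obtain ⟨a, b, x, y, hxy, e, rfl⟩ := h
  obtain ⟨x, y, hxy', rfl, rfl⟩ : ∃ x' y', ((x', y') ∈ R ∨ (y', x') ∈ R) ∧ x = x'.map φ ∧
      y = y'.map φ := by
    simp only [mem_mapRel] at hxy
    rcases hxy with ⟨x', y', h, h₁, h₂⟩ | ⟨x', y', h, h₁, h₂⟩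
    · exact ⟨x', y', Or.inl h, h₁, h₂⟩
    · exact ⟨y', x', Or.inr h, h₂, h₁⟩
  have key : ∃ m, u.map φ = a ++ x.map φ ++ m ∧ b = m ++ t := by
    rcases List.append_eq_append_iff.1 e with ⟨m, h₁, h₂⟩ | ⟨m, h₁, h₂⟩
    · rcases List.eq_nil_or_concat m with rfl | ⟨m, c, rfl⟩
      · exact ⟨[], by simp_all, by simp_all⟩
      · obtain ⟨x', d, rfl⟩ := (List.eq_nil_or_concat x).resolve_left (hne x ⟨y, hxy'⟩)
        rw [List.concat_eq_append, List.concat_eq_append, List.map_append, ← List.append_assoc,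
          ← List.append_assoc] at h₁
        have hc : φ d = c := by simpa using (List.append_inj' h₁ rfl).2
        exact absurd (by simp [h₂, hc]) (ht d)
    · exact ⟨m, h₁, h₂⟩
  obtain ⟨m, e', rfl⟩ := key
  rw [List.map_eq_append_iff] at e'
  obtain ⟨u₁, m, rfl, e', rfl⟩ := e'
  rw [List.map_eq_append_iff] at e'
  obtain ⟨a, x', rfl, rfl, e'⟩ := e'
  obtain rfl := List.map_injective_iff.2 hφ e'
  exact ⟨a ++ y ++ m, by simp, a, m, x', y, hxy', rfl, rfl⟩

theorem equivalent_mapRel_iff {φ : A → B} (hφ : Function.Injective φ)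
    (hne : ∀ w, IsRelationWord R w → w ≠ []) {t : List B} (ht : ∀ a, φ a ∉ t) {u v : List A} :
    Equivalent (mapRel φ R) (u.map φ ++ t) (v.map φ ++ t) ↔ Equivalent R u v := by
  constructor
  · intro h
    suffices H : ∀ w, Equivalent (mapRel φ R) (u.map φ ++ t) w →
        ∃ v, w = v.map φ ++ t ∧ Equivalent R u v by
      obtain ⟨v', e, h⟩ := H _ h
      rwa [List.map_injective_iff.2 hφ (List.append_cancel_right e)]
    intro w h
    induction h with
    | refl => exact ⟨u, rfl, .refl⟩
    | tail _ hstep ih =>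
      obtain ⟨v', rfl, h⟩ := ih
      obtain ⟨v'', rfl, h'⟩ := hstep.of_mapRel hφ hne ht
      exact ⟨v'', rfl, h.tail h'⟩
  · refine Relation.ReflTransGen.lift (fun w : List A => w.map φ ++ t) ?_ _ _
    rintro _ _ ⟨a, b, x, y, hxy, rfl, rfl⟩
    refine ⟨a.map φ, b.map φ ++ t, x.map φ, y.map φ, ?_, by simp, by simp⟩
    simp only [mem_mapRel]
    exact hxy.imp (fun h => ⟨x, y, h, rfl, rfl⟩) fun h => ⟨y, x, h, rfl, rfl⟩

/-! ### Reversal -/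

/-- The relations written backwards. -/
def revRel (R : Set (List A × List A)) : Set (List A × List A) :=
  {r | (r.1.reverse, r.2.reverse) ∈ R}

theorem isRelationWord_revRel {w : List A} :
    IsRelationWord (revRel R) w ↔ IsRelationWord R w.reverse := by
  constructor
  · rintro ⟨x, h⟩
    exact ⟨x.reverse, h⟩
  · rintro ⟨x, h⟩
    exact ⟨x.reverse, by simpa [revRel] using h⟩

theorem IsPiece.of_revRel {p : List A} (h : IsPiece (revRel R) p) : IsPiece R p.reverse := by
  rcases h with rfl | ⟨w₁, w₂, s₁, t₁, s₂, t₂, h₁, h₂, e₁, e₂, hne⟩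
  · exact Or.inl rfl
  · refine Or.inr ⟨_, _, t₁.reverse, s₁.reverse, t₂.reverse, s₂.reverse,
      isRelationWord_revRel.1 h₁, isRelationWord_revRel.1 h₂, by simp [e₁], by simp [e₂], ?_⟩
    by_contra h
    push Not at h
    obtain ⟨h, ht⟩ := h
    obtain rfl := List.reverse_injective h
    obtain rfl := List.reverse_injective ht
    rw [e₁, List.append_assoc, List.append_assoc] at e₂
    exact hne.elim (fun h => h rfl) fun h => h (List.append_cancel_right e₂)

theorem SatisfiesC.revRel {m : ℕ} (hC : SatisfiesC m R) : SatisfiesC m (revRel R) := by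
  rintro w hw ⟨ps, hlen, hps, rfl⟩
  refine hC _ (isRelationWord_revRel.1 hw) ⟨(ps.map List.reverse).reverse, by simpa using hlen,
    fun p hp => ?_, List.reverse_flatten.symm⟩
  rw [List.mem_reverse, List.mem_map] at hp
  obtain ⟨q, hq, rfl⟩ := hp
  exact (hps q hq).of_revRel

theorem Equivalent.reverse {u v : List A} (h : Equivalent (revRel R) u v) :
    Equivalent R u.reverse v.reverse := by
  refine Relation.ReflTransGen.lift List.reverse ?_ _ _ h
  rintro _ _ ⟨a, b, x, y, hxy, rfl, rfl⟩
  exact ⟨b.reverse, a.reverse, x.reverse, y.reverse, hxy, by simp, by simp⟩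

theorem revRel_revRel : revRel (revRel R) = R := by
  ext r
  simp [revRel]

theorem reverseRelation_wordProblem :
    reverseRelation (wordProblem R) = wordProblem (revRel R) := by
  ext ⟨u, v⟩
  constructor
  · rintro ⟨⟨u', v'⟩, h, e⟩
    obtain ⟨rfl, rfl⟩ := Prod.mk.inj e
    exact Equivalent.reverse (R := revRel R) (revRel_revRel.symm ▸ h)
  · intro h
    exact ⟨(u.reverse, v.reverse), Equivalent.reverse h, by simp⟩

/-! ### Automata over other alphabets -/

/-- Letters can be renamed before they are read by an automaton. -/
theorem IsDeterministicRational.preimage {T : Set (List B × List B)}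
    (hT : IsDeterministicRational T) (φ : A → B) :
    IsDeterministicRational {p : List A × List A | (p.1.map φ, p.2.map φ) ∈ T} := by
  obtain ⟨Q, hQ, M, rfl⟩ := hT
  let N : TwoTapeDFA A A Q :=
    ⟨M.Q₁, M.start, M.terminal, fun q a => M.δ₁ q (a.map φ), fun q a => M.δ₂ q (a.map φ)⟩
  let F : List (EndMarked A) × List (EndMarked A) × Q →
      List (EndMarked B) × List (EndMarked B) × Q :=
    fun c => (c.1.map (Option.map φ), c.2.1.map (Option.map φ), c.2.2)
  have h₁ : ∀ c d, N.Step c d → M.Step (F c) (F d) := by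
    intro c d h
    cases h with
    | tape₁ a u v p q hp h => exact .tape₁ _ _ _ p q hp h
    | tape₂ b u v p q hp h => exact .tape₂ _ _ _ p q hp h
  have h₂ : ∀ c d, M.Step (F c) d → ∃ d', d = F d' ∧ N.Step c d' := by
    rintro ⟨u, v, p⟩ d h
    generalize hc : F (u, v, p) = c at h
    cases h with
    | tape₁ a u' v' p' q hp h =>
      simp only [F, Prod.mk.injEq] at hc
      obtain ⟨hu, rfl, rfl⟩ := hc
      obtain ⟨b, u, rfl, rfl, rfl⟩ := List.map_eq_cons_iff.1 hu
      exact ⟨(u, v, q), rfl, .tape₁ _ _ _ p q hp h⟩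
    | tape₂ b u' v' p' q hp h =>
      simp only [F, Prod.mk.injEq] at hc
      obtain ⟨rfl, hv, rfl⟩ := hc
      obtain ⟨b, v, rfl, rfl, rfl⟩ := List.map_eq_cons_iff.1 hv
      exact ⟨(u, v, q), rfl, .tape₂ _ _ _ p q hp h⟩
  have hend : ∀ w : List A, (endMark w).map (Option.map φ) = endMark (w.map φ) := fun w => by
    simp [endMark]
  refine ⟨Q, hQ, N, ?_⟩
  ext ⟨u, v⟩
  simp only [TwoTapeDFA.accepts, Set.mem_ofPred_eq]
  refine exists_congr fun q => and_congr_right fun _ => ?_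
  rw [← hend, ← hend]
  constructor
  · intro h
    exact Relation.ReflTransGen.lift F h₁ _ _ h
  · intro h
    suffices H : ∀ d, Relation.ReflTransGen M.Step (F (endMark u, endMark v, N.start)) d →
        ∃ d', d = F d' ∧ Relation.ReflTransGen N.Step (endMark u, endMark v, N.start) d' by
      obtain ⟨⟨u', v', q'⟩, e, h⟩ := H _ h
      simp only [F, Prod.mk.injEq, List.nil_eq, List.map_eq_nil_iff] at e
      obtain ⟨rfl, rfl, rfl⟩ := e
      exact h
    intro d h
    induction h with
    | refl => exact ⟨_, rfl, .refl⟩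
    | tail _ hs ih =>
      obtain ⟨d', rfl, h⟩ := ih
      obtain ⟨d'', rfl, h'⟩ := h₂ _ _ hs
      exact ⟨d'', rfl, h.tail h'⟩

end Transfer

section Final

/-! ### The word problem -/

variable {n : ℕ}

theorem setOf_mem_encodePresentation (L : List (List (Fin n) × List (Fin n))) :
    {r | r ∈ (encodePresentation n L).2} = mapRel Fin.val {r | r ∈ L} := by
  ext r
  simp [encodePresentation, mapRel, Prod.map]

theorem automaton_recognises (L : List (List (Fin n) × List (Fin n)))
    (hC : SatisfiesC 4 {r | r ∈ L}) :
    (automaton n (encodePresentation n L).2).Recognises (wordProblem {r | r ∈ L}) := by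
  have hset := setOf_mem_encodePresentation L
  have hL : LettersLT (encodePresentation n L).2 n := by
    intro w hw a ha
    rw [hset] at hw
    obtain ⟨w, -, rfl⟩ := hw.of_mapRel
    obtain ⟨b, -, rfl⟩ := List.mem_map.1 ha
    exact b.2
  refine ⟨dfa _ n, describes_dfa, ?_⟩
  ext ⟨u, v⟩
  rw [mem_accepts_dfa hL, hset, ← equivalent_iff_eqv (hC.mapRel Fin.val_injective),
    equivalent_mapRel_iff Fin.val_injective fun w => hC.ne_nil]
  · rfl
  · intro a
    rw [List.mem_singleton]
    exact a.2.ne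

theorem isDeterministicRational_wordProblem {A : Type*} [Finite A] {R : Set (List A × List A)}
    (hR : R.Finite) (hC : SatisfiesC 4 R) : IsDeterministicRational (wordProblem R) := by
  obtain ⟨n, ⟨e⟩⟩ := Finite.exists_equiv_fin A
  have hset : {r | r ∈ hR.toFinset.toList.map (Prod.map (List.map e) (List.map e))} =
      mapRel e R := by
    ext r
    simp [mapRel]
  have hrec := automaton_recognises (hR.toFinset.toList.map (Prod.map (List.map e) (List.map e)))
    (by rw [hset]; exact hC.mapRel e.injective)
  obtain ⟨M, -, hM⟩ := hrec
  have hT : IsDeterministicRational (wordProblem (mapRel e R)) :=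
    ⟨_, List.finite_toSet _, M, by rw [hM, hset]⟩
  convert hT.preimage e using 1
  ext ⟨u, v⟩
  have := equivalent_mapRel_iff (t := []) e.injective (fun w => hC.ne_nil (w := w)) (by simp)
    (u := u) (v := v)
  simpa [wordProblem] using this.symm

/-- Codes for automata for the presentation with the given code and for its reverse. -/
def automata (c : PresentationCode) : AutomatonCode × AutomatonCode :=
  (automaton c.1 c.2, automaton c.1 (c.2.map fun r => (r.1.reverse, r.2.reverse)))

theorem computable_automata : Computable automata := by
  have : Primrec automata := by
    unfold automata
    fun_prop
  exact this.to_comp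

end Final

end SmallOverlap

/-- The word problem relation of a finite `C(4)` monoid presentation is deterministic rational and
reverse deterministic rational, and there is a single algorithm that computes, from such a
presentation, automata for the relation and for its reverse. -/
theorem mainTheorem1 :
    (∀ (A : Type*) [Finite A] (R : Set (List A × List A)), R.Finite →
      SmallOverlap.SatisfiesC 4 R →
        SmallOverlap.IsDeterministicRational (SmallOverlap.wordProblem R) ∧
        SmallOverlap.IsReverseDeterministicRational (SmallOverlap.wordProblem R)) ∧
    (∃ f : SmallOverlap.PresentationCode →
        SmallOverlap.AutomatonCode × SmallOverlap.AutomatonCode,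
      Computable f ∧
      ∀ (n : ℕ) (L : List (List (Fin n) × List (Fin n))),
        SmallOverlap.SatisfiesC 4 {r | r ∈ L} →
          SmallOverlap.AutomatonCode.Recognises
            (f (SmallOverlap.encodePresentation n L)).1
            (SmallOverlap.wordProblem {r | r ∈ L}) ∧
          SmallOverlap.AutomatonCode.Recognises
            (f (SmallOverlap.encodePresentation n L)).2
            (SmallOverlap.reverseRelation (SmallOverlap.wordProblem {r | r ∈ L}))) := by
  refine ⟨fun A _ R hR hC => ⟨SmallOverlap.isDeterministicRational_wordProblem hR hC, ?_⟩,
    SmallOverlap.automata, SmallOverlap.computable_automata, fun n L hC =>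
      ⟨SmallOverlap.automaton_recognises L hC, ?_⟩⟩
  · rw [SmallOverlap.IsReverseDeterministicRational, SmallOverlap.reverseRelation_wordProblem]
    refine SmallOverlap.isDeterministicRational_wordProblem ?_ hC.revRel
    refine hR.preimage (Function.Injective.injOn fun r s h => ?_)
    have h := Prod.mk.inj h
    exact Prod.ext (List.reverse_injective h.1) (List.reverse_injective h.2)
  · have hset : {r | r ∈ L.map fun r => (r.1.reverse, r.2.reverse)} =
        SmallOverlap.revRel {r | r ∈ L} := by
      ext ⟨x, y⟩
      simp only [Set.mem_ofPred_eq, List.mem_map, SmallOverlap.revRel]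
      constructor
      · rintro ⟨r, hr, e⟩
        obtain ⟨rfl, rfl⟩ := Prod.mk.inj e
        simpa using hr
      · exact fun h => ⟨_, h, by simp⟩
    have hcode : (SmallOverlap.automata (SmallOverlap.encodePresentation n L)).2 =
        SmallOverlap.automaton n (SmallOverlap.encodePresentation n
          (L.map fun r => (r.1.reverse, r.2.reverse))).2 := by
      simp [SmallOverlap.automata, SmallOverlap.encodePresentation, Function.comp_def]
    rw [hcode, SmallOverlap.reverseRelation_wordProblem, ← hset]
    exact SmallOverlap.automaton_recognises _ (by rw [hset]; exact hC.revRel)
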